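/- Let $p$ be a prime, $\omega=e^{2\pi i/p}$. A skeletal bimodule over $\mathrm{Vec}(\mathbb Z/p)$ is a set of simple objects $m$ with commuting left and right actions $g\triangleright m$, $m\triangleleft h$ of $\mathbb Z/p$, and nonzero scalars (left, middle and right associators) satisfying the pentagon and unit equations. Consider the following ones (all associators trivial unless stated): * $T$: objects $(a,b)\in(\mathbb Z/p)^2$, $g\triangleright(a,b)\triangleleft h=(a+g,b+h)$; * $L$: objects $a\in\mathbb Z/p$, $g\triangleright a\triangleleft h=a+h$; $\quad R$: objects $a\in\mathbb Z/p$, $g\triangleright a\triangleleft h=a+g$; * $X_k$ ($k\in(\mathbb Z/p)^\times$): objects $a\in\mathbb Z/p$, $g\triangleright a\triangleleft h=a+g+kh$; * $F_q$ ($q\in\mathbb Z/p$): one object $*$, middle associator $g\triangleright(*\triangleleft h)\to(g\triangleright *)\triangleleft h$ equal to $\omega^{qgh}$. For two such bimodules $M,N$ let $\mathrm{Ann}(M,N)$ be the $\mathbb C$-linear category whose objects are pairs $(m,n)$ of simple objects, and where $\mathrm{Hom}((m,n),(m',n'))$ has as basis the annular diagrams $[g,h]$ (left string $g$, right string $h$,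 outer labels $(m,n)$, inner labels $(m',n')$) with $(g\triangleright m')\triangleleft h=m$ and $(g\triangleright n')\triangleleft h=n$. Diagrams are composed by nesting, the strings being added; the scalar is the associator of $M$ times the inverse associator of $N$ for regrouping $(g_1\triangleright((g_0\triangleright -)\triangleleft h_0))\triangleleft h_1$ into $((g_1+g_0)\triangleright -)\triangleleft(h_0+h_1)$. The binary interface defects between $M$ and $N$ are the simple objects of the Karoubi envelope of $\mathrm{Ann}(M,N)$, up to isomorphism. Write $[g,h]_{m,n}$ for the endomorphism $[g,h]$ of $(m,n)$ and put $\Theta_{x,a}(g)=(-1)^{gx}i^{ag}$ if $p=2$ (representatives in $\{0,1\}$) and $\Theta_{x,a}(g)=\omega^{gx+ag^2 2^{-1}}$ if $p>2$ (with $2^{-1}$ modulo $p$). Below $k,l,q,r\in\mathbb Z/p$ are nonzero, $a,b,x,y$ run over $\mathbb Z/p$ and label the defects, and sums are over $\mathbb Z/p$. **Theorem.** For each pair $M$–$N$ of bimodules among $T,L,R,F_0,X_k,F_q$, the endomorphisms listed below are idempotents; they define simple objects of the Karoubi envelope of $\mathrm{Ann}(M,N)$, different labels give non-isomorphic objects,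 and every simple object is isomorphic to one of them. Moreover, an object $(A,e)$ of the Karoubi envelope is simple if and only if $e$ is an indecomposable idempotent. * $T$–$T$: $[0,0]_{(0,0),(a,b)}$; $T$–$L$, $T$–$R$, $T$–$X_l$: $[0,0]_{(0,0),a}$; $T$–$F_0$, $T$–$F_r$: $[0,0]_{(0,0),*}$. * $L$–$T$: $[0,0]_{0,(0,a)}$; $L$–$L$: $\frac1p\sum_g\omega^{gx}[g,0]_{0,a}$; $L$–$R$, $L$–$X_l$: $[0,0]_{0,0}$; $L$–$F_0$, $L$–$F_r$: $\frac1p\sum_g\omega^{gx}[g,0]_{0,*}$. * $R$–$T$: $[0,0]_{0,(a,0)}$; $R$–$R$: $\frac1p\sum_g\omega^{gx}[0,-g]_{0,a}$; $R$–$L$, $R$–$X_l$: $[0,0]_{0,0}$; $R$–$F_0$, $R$–$F_r$: $\frac1p\sum_g\omega^{gx}[0,-g]_{0,*}$. * $F_0$–$T$: $[0,0]_{*,(0,0)}$; $F_0$–$L$: $\frac1p\sum_g\omega^{gx}[g,0]_{*,0}$; $F_0$–$R$: $\frac1p\sum_g\omega^{gx}[0,-g]_{*,0}$; $F_0$–$F_0$: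 $\frac1{p^2}\sum_{g,h}\omega^{gx+hy}[g,-h]_{*,*}$; $F_0$–$X_l$: $\frac1p\sum_g\omega^{gx}[g,-l^{-1}g]_{*,0}$; $F_0$–$F_r$: $\frac1p\sum_g[0,-g]_{*,*}$. * $X_k$–$T$: $[0,0]_{0,(a,0)}$; $X_k$–$L$, $X_k$–$R$: $[0,0]_{0,0}$; $X_k$–$F_0$: $\frac1p\sum_g\omega^{gx}[g,-k^{-1}g]_{0,*}$; $X_k$–$X_k$: $\frac1p\sum_g\omega^{gx}[kg,-g]_{0,a}$ ($p^2$ defects); $X_k$–$X_l$ with $k\ne l$: $[0,0]_{0,0}$ (one defect); $X_k$–$F_r$: $\frac1p\sum_g\Theta_{x,kr}(g)[kg,-g]_{0,*}$ ($p$ defects). * $F_q$–$T$: $[0,0]_{*,(0,0)}$; $F_q$–$L$: $\frac1p\sum_g\omega^{gx}[g,0]_{*,0}$; $F_q$–$R$: $\frac1p\sum_g\omega^{gx}[0,-g]_{*,0}$; $F_q$–$F_0$: $\frac1p\sum_g[0,-g]_{*,*}$; $F_q$–$X_l$: $\frac1p\sum_g\Theta_{x,-ql}(g)[lg,-g]_{*,0}$;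 $F_q$–$F_q$: $\frac1{p^2}\sum_{g,h}\omega^{gx+hy}[g,-h]_{*,*}$; $F_q$–$F_r$ with $q\neq r$: $\frac1p\sum_g[0,-g]_{*,*}$ (one defect). In addition (here $q$ and $r$ may be zero): * For $X_k$–$F_r$, the endomorphisms $M_g=[-kg,g]_{0,*}$ satisfy $M_gM_h=\omega^{krgh}M_{g+h}$, and $U_g=\Theta_{0,kr}(g)M_g$ satisfy $U_gU_h=U_{g+h}$. * For $F_q$–$F_r$, the endomorphisms $M_{g,h}=[g,h]_{*,*}$ satisfy $M_{g_0,h_0}M_{g_1,h_1}=\omega^{(q-r)h_0g_1}M_{g_0+g_1,h_0+h_1}$. If $q\ne r$, then $M_{g,h}\mapsto X^{(q-r)g}Z^h$, where $Xe_j=e_{j+1}$ and $Ze_j=\omega^je_j$, defines an isomorphism of algebras from $\mathrm{End}((*,*))$ to the $p\times p$ complex matrices, and it maps $\frac1p\sum_gM_{0,g}$ to the matrix unit $E_{00}$. -/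

import Mathlib

open CategoryTheory

/-- Skeletal data of a bimodule category over the fusion category `Vec(ℤ/p)` (trivial associator,
strict unit): the set `Obj` of (isomorphism classes of) simple objects, the left and right actions
of the simple objects of `Vec(ℤ/p)` on it (each `g ▷ m` and `m ◁ h` being simple), and the
associativity isomorphisms
* `lam g g' m : g ▷ (g' ▷ m) ⟶ (g + g') ▷ m`,
* `rho m h h' : (m ◁ h) ◁ h' ⟶ m ◁ (h + h')`,
* `mid g m h : g ▷ (m ◁ h) ⟶ (g ▷ m) ◁ h`,
each of which is a nonzero scalar, subject to the four pentagon equations and to the triangle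
equations for strict unit constraints. -/
structure SkeletalBimodule (p : ℕ) where
  Obj : Type
  lact : ZMod p → Obj → Obj
  ract : Obj → ZMod p → Obj
  zero_lact : ∀ m, lact 0 m = m
  ract_zero : ∀ m, ract m 0 = m
  lact_lact : ∀ g g' m, lact g (lact g' m) = lact (g + g') m
  ract_ract : ∀ m h h', ract (ract m h) h' = ract m (h + h')
  lact_ract : ∀ g m h, lact g (ract m h) = ract (lact g m) h
  lam : ZMod p → ZMod p → Obj → ℂˣ
  rho : Obj → ZMod p → ZMod p → ℂˣ
  mid : ZMod p → Obj → ZMod p → ℂˣ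
  lam_zero_left : ∀ g m, lam 0 g m = 1
  lam_zero_right : ∀ g m, lam g 0 m = 1
  rho_zero_left : ∀ m h, rho m 0 h = 1
  rho_zero_right : ∀ m h, rho m h 0 = 1
  mid_zero_left : ∀ m h, mid 0 m h = 1
  mid_zero_right : ∀ g m, mid g m 0 = 1
  pentagon_left : ∀ g g' g'' m,
    lam g g' (lact g'' m) * lam (g + g') g'' m = lam g' g'' m * lam g (g' + g'') m
  pentagon_right : ∀ m h h' h'',
    rho (ract m h) h' h'' * rho m h (h' + h'') = rho m h h' * rho m (h + h') h''
  pentagon_mid_left : ∀ g g' m h,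
    lam g g' (ract m h) * mid (g + g') m h = mid g' m h * mid g (lact g' m) h * lam g g' m
  pentagon_mid_right : ∀ g m h h',
    rho m h h' * mid g m (h + h') = mid g (ract m h) h' * mid g m h * rho (lact g m) h h'

namespace SkeletalBimodule

variable {p : ℕ}

/-- `a = (g, h)` sends a simple object `m` to `(g ▷ m) ◁ h`. -/
def act (M : SkeletalBimodule p) (a : ZMod p × ZMod p) (m : M.Obj) : M.Obj :=
  M.ract (M.lact a.1 m) a.2

/-- For `a = (g₁, h₁)` (outer strings) and `b = (g₀, h₀)` (inner strings), the scalar of the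
associativity isomorphism
`(g₁ ▷ ((g₀ ▷ m) ◁ h₀)) ◁ h₁ ⟶ ((g₁ ▷ (g₀ ▷ m)) ◁ h₀) ◁ h₁ ⟶ (((g₁ + g₀) ▷ m) ◁ h₀) ◁ h₁
  ⟶ ((g₁ + g₀) ▷ m) ◁ (h₀ + h₁)`. -/
def assoc (M : SkeletalBimodule p) (a b : ZMod p × ZMod p) (m : M.Obj) : ℂˣ :=
  M.mid a.1 (M.lact b.1 m) b.2 * M.lam a.1 b.1 m * M.rho (M.lact (a.1 + b.1) m) b.2 a.2

theorem act_zero (M : SkeletalBimodule p) (m : M.Obj) : M.act 0 m = m := by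
  simp [act, M.zero_lact, M.ract_zero]

theorem act_act (M : SkeletalBimodule p) (a b : ZMod p × ZMod p) (m : M.Obj) :
    M.act a (M.act b m) = M.act (a + b) m := by
  simp [act, M.lact_ract, M.ract_ract, M.lact_lact, add_comm]

theorem assoc_zero_left (M : SkeletalBimodule p) (b : ZMod p × ZMod p) (m : M.Obj) :
    M.assoc 0 b m = 1 := by
  simp [assoc, M.mid_zero_left, M.lam_zero_left, M.rho_zero_right]

theorem assoc_zero_right (M : SkeletalBimodule p) (a : ZMod p × ZMod p) (m : M.Obj) :
    M.assoc a 0 m = 1 := by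
  simp [assoc, M.mid_zero_right, M.lam_zero_right, M.rho_zero_left]

theorem assoc_cocycle (M : SkeletalBimodule p) (a b c : ZMod p × ZMod p) (m : M.Obj) :
    M.assoc a b (M.act c m) * M.assoc (a + b) c m = M.assoc b c m * M.assoc a (b + c) m := by
  obtain ⟨a1, a2⟩ := a
  obtain ⟨b1, b2⟩ := b
  obtain ⟨c1, c2⟩ := c
  have h1 := M.pentagon_left a1 b1 c1 m
  have h2 := M.pentagon_mid_left a1 b1 (M.lact c1 m) c2
  have h3 := M.pentagon_mid_right a1 (M.lact b1 (M.lact c1 m)) c2 b2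
  have h4 := M.pentagon_right (M.lact (a1 + b1 + c1) m) c2 b2 a2
  simp only [assoc, act, Prod.mk_add_mk, M.lact_ract, M.lact_lact] at h1 h2 h3 h4 ⊢
  rw [← add_assoc] at *
  rw [add_comm b2 a2] at h4
  rw [add_comm b2 c2] at *
  have key := congrArg₂ (· * ·) (congrArg₂ (· * ·) h1 h2) (congrArg₂ (· * ·) h3.symm h4)
  refine mul_right_cancel (b := M.lam a1 b1 (M.lact c1 m) * M.mid a1 (M.lact (b1 + c1) m) c2 *
    M.rho (M.lact (a1 + b1 + c1) m) c2 b2) ?_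
  simp only [← Units.val_inj, Units.val_mul] at key ⊢
  linear_combination key

end SkeletalBimodule

/-- The annular category of a pair of bimodule categories `M`, `N` over `Vec(ℤ/p)`: the objects are
pairs `(m, n)` of simple objects `m` of `M` and `n` of `N`. -/
structure Ann {p : ℕ} (M N : SkeletalBimodule p) where
  fst : M.Obj
  snd : N.Obj

namespace Ann

variable {p : ℕ} {M N : SkeletalBimodule p}

/-- The annular diagram with outer labels `X`, inner labels `Y`, left string `a.1` and right string
`a.2` exists: the bottom vertex lies in `Hom((g ▷ m') ◁ h, m)` and the top vertex in
`Hom(n, (g ▷ n') ◁ h)`, where `a = (g, h)`, `X = (m, n)` and `Y = (m', n')`. -/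
def Composable (X Y : Ann M N) (a : ZMod p × ZMod p) : Prop :=
  M.act a Y.fst = X.fst ∧ N.act a Y.snd = X.snd

theorem Composable.add {X Y Z : Ann M N} {a b : ZMod p × ZMod p}
    (h : Composable X Y a) (h' : Composable Y Z b) : Composable X Z (a + b) :=
  ⟨by rw [← M.act_act, h'.1, h.1], by rw [← N.act_act, h'.2, h.2]⟩

theorem Composable.refl (X : Ann M N) : Composable X X 0 :=
  ⟨M.act_zero _, N.act_zero _⟩

/-- The morphisms `X ⟶ Y`: formal complex linear combinations of the annular diagrams with outer
labels `X` and inner labels `Y`, written as functions of the pair of strings. -/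
def homSpace (X Y : Ann M N) : Submodule ℂ (ZMod p × ZMod p → ℂ) where
  carrier := {f | ∀ a, ¬ Composable X Y a → f a = 0}
  add_mem' := fun hf hg a ha => by simp [hf a ha, hg a ha]
  zero_mem' := fun _ _ => rfl
  smul_mem' := fun c f hf a ha => by simp [hf a ha]

/-- The scalar by which the diagram with strings `b` and inner labels `Y`, placed inside the diagram
with strings `a`, differs from the diagram with strings `a + b`: the associator of `M` at the bottom
and the inverse associator of `N` at the top. -/
noncomputable def phase (Y : Ann M N) (a b : ZMod p × ZMod p) : ℂ :=
  ((M.assoc a b Y.fst * (N.assoc a b Y.snd)⁻¹ : ℂˣ) : ℂ)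

theorem phase_zero_left (Y : Ann M N) (b : ZMod p × ZMod p) : phase Y 0 b = 1 := by
  simp [phase, SkeletalBimodule.assoc_zero_left]

theorem phase_zero_right (Y : Ann M N) (a : ZMod p × ZMod p) : phase Y a 0 = 1 := by
  simp [phase, SkeletalBimodule.assoc_zero_right]

theorem phase_cocycle {Y Z : Ann M N} (a b c : ZMod p × ZMod p) (h : Composable Y Z c) :
    phase Y a b * phase Z (a + b) c = phase Z b c * phase Z a (b + c) := by
  have h1 := M.assoc_cocycle a b c Z.fst
  have h2 := N.assoc_cocycle a b c Z.snd
  rw [h.1] at h1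
  rw [h.2] at h2
  have key : (M.assoc a b Y.fst * (N.assoc a b Y.snd)⁻¹) *
      (M.assoc (a + b) c Z.fst * (N.assoc (a + b) c Z.snd)⁻¹) =
      (M.assoc b c Z.fst * (N.assoc b c Z.snd)⁻¹) *
      (M.assoc a (b + c) Z.fst * (N.assoc a (b + c) Z.snd)⁻¹) := by
    rw [mul_mul_mul_comm, mul_mul_mul_comm (M.assoc b c Z.fst), ← mul_inv, ← mul_inv, h1, h2]
  simpa only [phase, ← Units.val_mul] using congrArg Units.val key

variable [NeZero p]

/-- Nesting of annular diagrams: `f` outside, `k` inside. -/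
noncomputable def compFun {X Y Z : Ann M N} (f : homSpace X Y) (k : homSpace Y Z) :
    homSpace X Z :=
  ⟨fun c => ∑ b : ZMod p × ZMod p, f.1 (c - b) * k.1 b * phase Z (c - b) b, by
    intro c hc
    refine Finset.sum_eq_zero fun b _ => ?_
    by_cases h1 : Composable X Y (c - b)
    · by_cases h2 : Composable Y Z b
      · exact absurd (by simpa using h1.add h2) hc
      · simp [k.2 b h2]
    · simp [f.2 _ h1]⟩

/-- The identity of `X`: the annular diagram with labels `X` and trivial strings. -/
def idFun (X : Ann M N) : homSpace X X :=
  ⟨fun a => if a = 0 then 1 else 0, by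
    intro a ha
    have : a ≠ 0 := fun h => ha (h ▸ Composable.refl X)
    simp [this]⟩

noncomputable instance : Category (Ann M N) where
  Hom X Y := homSpace X Y
  id X := idFun X
  comp f k := compFun f k
  id_comp := by
    intro X Y f
    ext c
    simp only [compFun, idFun]
    rw [Finset.sum_eq_single c]
    · simp [phase_zero_left]
    · intro b _ hb
      simp [sub_eq_zero, hb.symm]
    · simp
  comp_id := by
    intro X Y f
    ext c
    simp only [compFun, idFun]
    rw [Finset.sum_eq_single 0]
    · simp [phase_zero_right]
    · intro b _ hb
      simp [hb]
    · simp
  assoc := by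
    intro W X Y Z f g k
    ext d
    simp only [compFun, Finset.sum_mul, Finset.mul_sum]
    rw [Finset.sum_comm (f := fun e c => f.1 (d - e) * (g.1 (e - c) * k.1 c * phase Z (e - c) c) *
      phase Z (d - e) e)]
    refine Finset.sum_congr rfl fun c _ => ?_
    refine Eq.trans ?_ (Equiv.sum_comp (Equiv.addRight c) _)
    refine Finset.sum_congr rfl fun b _ => ?_
    have e : d - (b + c) = d - c - b := by abel
    simp only [Equiv.coe_addRight, add_sub_cancel_right, e]
    by_cases hc : Composable Y Z c
    · have h := phase_cocycle (d - c - b) b c hc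
      rw [sub_add_cancel] at h
      linear_combination f.1 (d - c - b) * g.1 b * k.1 c * h
    · simp [k.2 c hc]

noncomputable instance : Preadditive (Ann M N) where
  homGroup X Y := inferInstanceAs (AddCommGroup (homSpace X Y))
  add_comp := by
    intro X Y Z f f' k
    refine Subtype.ext (funext fun c => ?_)
    change ∑ b, (f.1 (c - b) + f'.1 (c - b)) * k.1 b * phase Z (c - b) b =
      ∑ b, f.1 (c - b) * k.1 b * phase Z (c - b) b + ∑ b, f'.1 (c - b) * k.1 b * phase Z (c - b) b
    rw [← Finset.sum_add_distrib]
    exact Finset.sum_congr rfl fun b _ => by ring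
  comp_add := by
    intro X Y Z f k k'
    refine Subtype.ext (funext fun c => ?_)
    change ∑ b, f.1 (c - b) * (k.1 b + k'.1 b) * phase Z (c - b) b =
      ∑ b, f.1 (c - b) * k.1 b * phase Z (c - b) b + ∑ b, f.1 (c - b) * k'.1 b * phase Z (c - b) b
    rw [← Finset.sum_add_distrib]
    exact Finset.sum_congr rfl fun b _ => by ring

noncomputable instance : Linear ℂ (Ann M N) where
  homModule X Y := inferInstanceAs (Module ℂ (homSpace X Y))
  smul_comp := by
    intro X Y Z r f k
    refine Subtype.ext (funext fun c => ?_)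
    change ∑ b, (r * f.1 (c - b)) * k.1 b * phase Z (c - b) b =
      r * ∑ b, f.1 (c - b) * k.1 b * phase Z (c - b) b
    rw [Finset.mul_sum]
    exact Finset.sum_congr rfl fun b _ => by ring
  comp_smul := by
    intro X Y Z f r k
    refine Subtype.ext (funext fun c => ?_)
    change ∑ b, f.1 (c - b) * (r * k.1 b) * phase Z (c - b) b =
      r * ∑ b, f.1 (c - b) * k.1 b * phase Z (c - b) b
    rw [Finset.mul_sum]
    exact Finset.sum_congr rfl fun b _ => by ring

open Classical in
/-- The annular diagram with outer labels `X`, inner labels `Y`, left string `g` and right string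
`h`, as a morphism; it is `0` if there is no such diagram. -/
noncomputable def diagram (X Y : Ann M N) (g h : ZMod p) : X ⟶ Y :=
  (⟨fun a => if a = (g, h) ∧ Composable X Y a then 1 else 0, by
    intro a ha
    simp [ha]⟩ : homSpace X Y)

end Ann

/-- `e` is an indecomposable (primitive) idempotent: it is a nonzero idempotent which is not the sum
of two nonzero orthogonal idempotents. -/
def IsIndecomposableIdempotent {C : Type*} [Category* C] [Preadditive C] {X : C} (e : X ⟶ X) :
    Prop :=
  e ≫ e = e ∧ e ≠ 0 ∧ ∀ a b : X ⟶ X, a ≫ a = a → b ≫ b = b → a ≫ b = 0 → b ≫ a = 0 →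
    e = a + b → a = 0 ∨ b = 0

/-- The endomorphisms `e i` of the objects `A i` form a complete list, without repetition, of the
binary interface defects between the domain walls `M` and `N`, that is, of the simple objects of
the Karoubi envelope of the annular category up to isomorphism, and equally of the indecomposable
idempotents up to equivalence. -/
structure ClassifiesDefects {p : ℕ} [NeZero p] (M N : SkeletalBimodule p) {ι : Type}
    (A : ι → Ann M N) (e : ∀ i, A i ⟶ A i) : Prop where
  idem : ∀ i, e i ≫ e i = e i
  simple : ∀ i, Simple (⟨A i, e i, idem i⟩ : Idempotents.Karoubi (Ann M N))
  inequivalent : ∀ i j, Nonempty ((⟨A i, e i, idem i⟩ : Idempotents.Karoubi (Ann M N)) ≅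
    ⟨A j, e j, idem j⟩) → i = j
  exhaustive : ∀ P : Idempotents.Karoubi (Ann M N), Simple P →
    ∃ i, Nonempty (P ≅ ⟨A i, e i, idem i⟩)
  simple_iff : ∀ P : Idempotents.Karoubi (Ann M N), Simple P ↔ IsIndecomposableIdempotent P.p

/-- `ω x = exp (2πi x / p)`. -/
noncomputable def ω {p : ℕ} [NeZero p] (x : ZMod p) : ℂ := ZMod.stdAddChar x

/-- The function `Θ_{x,a}` on `ℤ/p`; for `p = 2` the arguments are represented by `0` and `1`. -/
noncomputable def Θ {p : ℕ} [NeZero p] (x a g : ZMod p) : ℂ :=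
  if p = 2 then (-1) ^ (g.val * x.val) * Complex.I ^ (a.val * g.val)
  else ω (g * x + a * g ^ 2 * 2⁻¹)

namespace Wall

variable (p : ℕ)

/-- `T`: `g ▷ (a, b) ◁ h = (a + g, b + h)`, trivial associators. -/
@[reducible] def T : SkeletalBimodule p where
  Obj := ZMod p × ZMod p
  lact g m := (m.1 + g, m.2)
  ract m h := (m.1, m.2 + h)
  lam _ _ _ := 1
  rho _ _ _ := 1
  mid _ _ _ := 1
  zero_lact := by simp
  ract_zero := by simp
  lact_lact g g' m := by simp only [Prod.mk.injEq, and_true]; ring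
  ract_ract m h h' := by simp only [Prod.mk.injEq, true_and]; ring
  lact_ract := by simp
  lam_zero_left := by simp
  lam_zero_right := by simp
  rho_zero_left := by simp
  rho_zero_right := by simp
  mid_zero_left := by simp
  mid_zero_right := by simp
  pentagon_left := by simp
  pentagon_right := by simp
  pentagon_mid_left := by simp
  pentagon_mid_right := by simp

/-- `L`: `g ▷ a ◁ h = a + h`, trivial associators. -/
@[reducible] def L : SkeletalBimodule p where
  Obj := ZMod p
  lact _ m := m
  ract m h := m + h
  lam _ _ _ := 1
  rho _ _ _ := 1
  mid _ _ _ := 1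
  zero_lact := by simp
  ract_zero := by simp
  lact_lact := by simp
  ract_ract m h h' := by ring
  lact_ract := by simp
  lam_zero_left := by simp
  lam_zero_right := by simp
  rho_zero_left := by simp
  rho_zero_right := by simp
  mid_zero_left := by simp
  mid_zero_right := by simp
  pentagon_left := by simp
  pentagon_right := by simp
  pentagon_mid_left := by simp
  pentagon_mid_right := by simp

/-- `R`: `g ▷ a ◁ h = a + g`, trivial associators. -/
@[reducible] def R : SkeletalBimodule p where
  Obj := ZMod p
  lact g m := m + g
  ract m _ := m
  lam _ _ _ := 1
  rho _ _ _ := 1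
  mid _ _ _ := 1
  zero_lact := by simp
  ract_zero := by simp
  lact_lact g g' m := by ring
  ract_ract := by simp
  lact_ract := by simp
  lam_zero_left := by simp
  lam_zero_right := by simp
  rho_zero_left := by simp
  rho_zero_right := by simp
  mid_zero_left := by simp
  mid_zero_right := by simp
  pentagon_left := by simp
  pentagon_right := by simp
  pentagon_mid_left := by simp
  pentagon_mid_right := by simp

variable {p}

/-- `X_k`: `g ▷ a ◁ h = a + g + k h`, trivial associators (used for `k ≠ 0`). -/
@[reducible] def X (k : ZMod p) : SkeletalBimodule p where
  Obj := ZMod p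
  lact g m := m + g
  ract m h := m + k * h
  lam _ _ _ := 1
  rho _ _ _ := 1
  mid _ _ _ := 1
  zero_lact := by simp
  ract_zero := by simp
  lact_lact g g' m := by ring
  ract_ract m h h' := by ring
  lact_ract g m h := by ring
  lam_zero_left := by simp
  lam_zero_right := by simp
  rho_zero_left := by simp
  rho_zero_right := by simp
  mid_zero_left := by simp
  mid_zero_right := by simp
  pentagon_left := by simp
  pentagon_right := by simp
  pentagon_mid_left := by simp
  pentagon_mid_right := by simp

/-- `F_q`: one simple object `*`, with middle associator `ω ^ (q g h)`; `F_0` is the case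
`q = 0`. -/
@[reducible] noncomputable def F [NeZero p] (q : ZMod p) : SkeletalBimodule p where
  Obj := Unit
  lact _ m := m
  ract m _ := m
  lam _ _ _ := 1
  rho _ _ _ := 1
  mid g _ h := Circle.toUnits (ZMod.toCircle (q * g * h))
  zero_lact := by simp
  ract_zero := by simp
  lact_lact := by simp
  ract_ract := by simp
  lact_ract := by simp
  lam_zero_left := by simp
  lam_zero_right := by simp
  rho_zero_left := by simp
  rho_zero_right := by simp
  mid_zero_left m h := by
    rw [mul_zero, zero_mul, AddChar.map_zero_eq_one, map_one]
  mid_zero_right g m := by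
    rw [mul_zero, AddChar.map_zero_eq_one, map_one]
  pentagon_left := by simp
  pentagon_right := by simp
  pentagon_mid_left g g' m h := by
    rw [one_mul, mul_one, ← map_mul, ← AddChar.map_add_eq_mul]
    congr 2
    ring
  pentagon_mid_right g m h h' := by
    rw [one_mul, mul_one, ← map_mul, ← AddChar.map_add_eq_mul]
    congr 2
    ring

end Wall

/-- The Pauli matrix `X`, `X e_j = e_{j+1}`. -/
def pauliX (p : ℕ) : Matrix (ZMod p) (ZMod p) ℂ := Matrix.of fun i j => if i = j + 1 then 1 else 0

/-- The Pauli matrix `Z`, `Z e_j = ω ^ j e_j`. -/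
noncomputable def pauliZ (p : ℕ) [NeZero p] : Matrix (ZMod p) (ZMod p) ℂ :=
  Matrix.diagonal fun j => ω j

open Ann Wall

set_option maxHeartbeats 2000000

/-! The annular category is a twisted action groupoid algebra: the strings `(ℤ/p)²` act on pairs
`(m, n)`, each diagram `[g, h]` is invertible up to a scalar, and diagrams multiply by adding
strings, up to the 2-cocycle `phase`. Simple objects of the Karoubi envelope therefore correspond to
an orbit together with an irreducible projective representation of its stabilizer.

The stabilizers that occur are trivial, a line in `(ℤ/p)²`, or the whole plane. A trivial one
contributes a single defect, the identity diagram. On a line the cocycle is a coboundary,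
trivialized by `1` or by the quadratic function `Θ`, and the defects are indexed by the characters
of `ℤ/p`. On the plane (`F_q`–`F_r`) the cocycle is trivial if `q = r`, giving `p²` characters. If
`q ≠ r` it is nondegenerate, the algebra is the `p × p` matrices generated by the Pauli matrices,
and a single defect remains.

Both kinds of idempotents satisfy `IsSplitGeneratingFamily`: they are nonzero, mutually orthogonal
across all morphisms, have corners `ℂ`, and factor every identity. Schur-type arguments then give
the whole classification without any abelian structure. The carriers are
`isSplitGeneratingFamily_charIdem`, `Θ_mul` and `endAlgEquivMatrix`. -/

/-! ### Simple objects of a Karoubi envelope from orthogonal idempotents with scalar corners. -/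

section SplitGenerators

variable {C : Type*} [Category* C] [Preadditive C] [Linear ℂ C]

/-- A family of pairwise orthogonal nonzero idempotents with scalar corners such that the two-sided
ideal generated by it contains all the identities. -/
structure IsSplitGeneratingFamily {ι : Type*} (A : ι → C) (e : ∀ i, A i ⟶ A i) : Prop where
  idem : ∀ i, e i ≫ e i = e i
  ne_zero : ∀ i, e i ≠ 0
  orthogonal : ∀ i j, i ≠ j → ∀ f : A i ⟶ A j, e i ≫ f ≫ e j = 0
  scalar : ∀ i (f : A i ⟶ A i), ∃ c : ℂ, e i ≫ f ≫ e i = c • e i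
  generates : ∀ Z : C, 𝟙 Z ∈ Submodule.span ℂ
    {u : Z ⟶ Z | ∃ (i : ι) (a : Z ⟶ A i) (b : A i ⟶ Z), u = a ≫ e i ≫ b}

namespace IsSplitGeneratingFamily

variable {ι : Type*} {A : ι → C} {e : ∀ i, A i ⟶ A i}

/-- Since `𝟙 Z` is a combination of morphisms passing through the `e i`, a morphism killed by all of
them equals `𝟙 Z ≫ f = 0`. Thus the family detects nonzero morphisms. -/
theorem exists_ne_zero_left (h : IsSplitGeneratingFamily A e) {Z Y : C} {f : Z ⟶ Y} (hf : f ≠ 0) :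
    ∃ (i : ι) (b : A i ⟶ Z), e i ≫ b ≫ f ≠ 0 := by
  by_contra! H
  refine hf ?_
  have key : ∀ u ∈ Submodule.span ℂ
      {u : Z ⟶ Z | ∃ (i : ι) (a : Z ⟶ A i) (b : A i ⟶ Z), u = a ≫ e i ≫ b}, u ≫ f = 0 := by
    intro u hu
    induction hu using Submodule.span_induction with
    | mem u hu => obtain ⟨i, a, b, rfl⟩ := hu; simp [H i b]
    | zero => simp
    | add u v _ _ hu hv => rw [Preadditive.add_comp, hu, hv, add_zero]
    | smul c u _ hu => rw [Linear.smul_comp, hu, smul_zero]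
  simpa using key _ (h.generates Z)

theorem exists_ne_zero_right (h : IsSplitGeneratingFamily A e) {Z Y : C} {f : Y ⟶ Z} (hf : f ≠ 0) :
    ∃ (i : ι) (a : Z ⟶ A i), f ≫ a ≫ e i ≠ 0 := by
  by_contra! H
  refine hf ?_
  have key : ∀ u ∈ Submodule.span ℂ
      {u : Z ⟶ Z | ∃ (i : ι) (a : Z ⟶ A i) (b : A i ⟶ Z), u = a ≫ e i ≫ b}, f ≫ u = 0 := by
    intro u hu
    induction hu using Submodule.span_induction with
    | mem u hu =>
      obtain ⟨i, a, b, rfl⟩ := hu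
      have := congrArg (· ≫ b) (H i a)
      simpa using this
    | zero => simp
    | add u v _ _ hu hv => rw [Preadditive.comp_add, hu, hv, add_zero]
    | smul c u _ hu => rw [Linear.comp_smul, hu, smul_zero]
  simpa using key _ (h.generates Z)

open Idempotents

/-- The object of the Karoubi envelope cut out by the `i`-th idempotent. -/
@[reducible] def obj (h : IsSplitGeneratingFamily A e) (i : ι) : Karoubi C := ⟨A i, e i, h.idem i⟩

/-- First half of Schur's lemma: a Karoubi morphism absorbs the idempotents at both ends, so
`orthogonal` applies to it. -/
theorem eq_of_hom_ne_zero (h : IsSplitGeneratingFamily A e) {i j : ι} {f : h.obj i ⟶ h.obj j}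
    (hf : f ≠ 0) : i = j := by
  by_contra hij
  refine hf (Karoubi.hom_ext _ _ ?_)
  rw [← Karoubi.p_comp f, ← Karoubi.comp_p f]
  exact h.orthogonal i j hij f.f

theorem exists_eq_smul (h : IsSplitGeneratingFamily A e) {i : ι} (f : h.obj i ⟶ h.obj i) :
    ∃ c : ℂ, f.f = c • e i := by
  rw [← Karoubi.p_comp f, ← Karoubi.comp_p f]
  exact h.scalar i f.f

theorem id_obj_ne_zero (h : IsSplitGeneratingFamily A e) (i : ι) : 𝟙 (h.obj i) ≠ 0 :=
  fun H => h.ne_zero i (congrArg Karoubi.Hom.f H)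

/-- Second half of Schur's lemma: the endomorphisms of `obj i` are scalars, and a nonzero scalar is
invertible. -/
theorem isIso_of_ne_zero (h : IsSplitGeneratingFamily A e) {i : ι} {f : h.obj i ⟶ h.obj i}
    (hf : f ≠ 0) : IsIso f := by
  obtain ⟨c, hc⟩ := h.exists_eq_smul f
  have hc0 : c ≠ 0 := by
    rintro rfl
    exact hf (Karoubi.hom_ext _ _ (by simpa using hc))
  refine ⟨⟨c⁻¹ • e i, by simp [h.idem i]⟩, ?_, ?_⟩ <;>
  · refine Karoubi.hom_ext _ _ ?_
    simp [hc, h.idem i, smul_smul, hc0]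

theorem exists_hom_comp_ne_zero (h : IsSplitGeneratingFamily A e) {P Q : Karoubi C} {f : P ⟶ Q}
    (hf : f ≠ 0) : ∃ (i : ι) (b : h.obj i ⟶ P), b ≫ f ≠ 0 := by
  obtain ⟨i, b, hb⟩ := h.exists_ne_zero_left (f := f.f) fun H => hf (Karoubi.hom_ext _ _ H)
  refine ⟨i, ⟨e i ≫ b ≫ P.p, by simp [reassoc_of% (h.idem i)]⟩, fun H => hb ?_⟩
  simpa using congrArg Karoubi.Hom.f H

theorem exists_comp_hom_ne_zero (h : IsSplitGeneratingFamily A e) {P Q : Karoubi C} {f : Q ⟶ P}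
    (hf : f ≠ 0) : ∃ (i : ι) (a : P ⟶ h.obj i), f ≫ a ≠ 0 := by
  obtain ⟨i, a, ha⟩ := h.exists_ne_zero_right (f := f.f) fun H => hf (Karoubi.hom_ext _ _ H)
  refine ⟨i, ⟨P.p ≫ a ≫ e i, by simp [h.idem i]⟩, fun H => ha ?_⟩
  simpa using congrArg Karoubi.Hom.f H

/-- Some map from `P` to an `obj j` does not kill `b`. Schur's lemma forces `j = i` and makes the
composite invertible, so correcting by its inverse splits `b`. -/
theorem exists_retraction (h : IsSplitGeneratingFamily A e) {i : ι} {P : Karoubi C}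
    {b : h.obj i ⟶ P} (hb : b ≠ 0) : ∃ s : P ⟶ h.obj i, b ≫ s = 𝟙 _ := by
  obtain ⟨j, a, ha⟩ := h.exists_comp_hom_ne_zero hb
  obtain rfl := h.eq_of_hom_ne_zero ha
  have := h.isIso_of_ne_zero ha
  exact ⟨a ≫ inv (b ≫ a), by rw [← Category.assoc, IsIso.hom_inv_id]⟩

theorem exists_section (h : IsSplitGeneratingFamily A e) {i : ι} {P : Karoubi C}
    {a : P ⟶ h.obj i} (ha : a ≠ 0) : ∃ s : h.obj i ⟶ P, s ≫ a = 𝟙 _ := by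
  obtain ⟨j, b, hb⟩ := h.exists_hom_comp_ne_zero ha
  obtain rfl := h.eq_of_hom_ne_zero hb
  have := h.isIso_of_ne_zero hb
  exact ⟨inv (b ≫ a) ≫ b, by rw [Category.assoc, IsIso.inv_hom_id]⟩

/-- A nonzero map into `obj i` has a section, and a monomorphism with a section is an isomorphism.
-/
theorem simple_obj (h : IsSplitGeneratingFamily A e) (i : ι) : Simple (h.obj i) where
  mono_isIso_iff_nonzero {Y} f _ := by
    constructor
    · rintro hf rfl
      exact h.id_obj_ne_zero i (by rw [← IsIso.inv_hom_id (0 : Y ⟶ h.obj i), Limits.comp_zero])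
    · intro hf
      obtain ⟨s, hs⟩ := h.exists_section hf
      exact ⟨s, by rw [← cancel_mono f, Category.assoc, hs, Category.comp_id, Category.id_comp], hs⟩

theorem exists_iso_of_simple (h : IsSplitGeneratingFamily A e) (P : Karoubi C) [Simple P] :
    ∃ i, Nonempty (P ≅ h.obj i) := by
  obtain ⟨i, b, hb⟩ := h.exists_hom_comp_ne_zero (id_nonzero P)
  rw [Category.comp_id] at hb
  obtain ⟨s, hs⟩ := h.exists_retraction hb
  have : Mono b := (SplitMono.mk s hs).mono
  have := isIso_of_mono_of_nonzero hb
  exact ⟨i, ⟨(asIso b).symm⟩⟩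

/-- Transport along `φ` shows that the corner of `P.p` is `ℂ`, which has no two nonzero orthogonal
idempotents. -/
theorem isIndecomposableIdempotent_of_iso (h : IsSplitGeneratingFamily A e) {P : Karoubi C} {i : ι}
    (φ : P ≅ h.obj i) : IsIndecomposableIdempotent P.p := by
  have scalar : ∀ a : P.X ⟶ P.X, P.p ≫ a ≫ P.p = a → ∃ c : ℂ, a = c • P.p := by
    intro a ha
    obtain ⟨c, hc⟩ := h.exists_eq_smul (φ.inv ≫ (⟨a, ha⟩ : P ⟶ P) ≫ φ.hom)
    refine ⟨c, ?_⟩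
    have h1 : (⟨a, ha⟩ : P ⟶ P) = φ.hom ≫ (φ.inv ≫ (⟨a, ha⟩ : P ⟶ P) ≫ φ.hom) ≫ φ.inv := by simp
    have h2 := congrArg Karoubi.Hom.f h1
    rw [Karoubi.comp_f, Karoubi.comp_f, hc] at h2
    have h3 : φ.hom.f ≫ e i = φ.hom.f := Karoubi.comp_p φ.hom
    have h4 : φ.hom.f ≫ φ.inv.f = P.p := congrArg Karoubi.Hom.f φ.hom_inv_id
    simpa [reassoc_of% h3, h4] using h2
  refine ⟨P.idem, fun H => ?_, ?_⟩
  · refine h.id_obj_ne_zero i ?_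
    have : 𝟙 P = 0 := Karoubi.hom_ext _ _ H
    rw [← φ.inv_hom_id, ← Category.id_comp φ.hom, this]
    simp
  · intro a b ha hb hab hba hp
    obtain ⟨c, hc⟩ := scalar a (by simp [hp, ha, hab, hba])
    obtain ⟨d, hd⟩ := scalar b (by simp [hp, hb, hab, hba])
    by_cases hc0 : c = 0
    · exact Or.inl (by rw [hc, hc0, zero_smul])
    · right
      -- With `a = c • P.p` and `b = d • P.p`, the product `a ≫ b` is `c • b`.
      have h1 : c • b = 0 := by
        rw [← hab]
        nth_rw 1 [hc]
        rw [hd]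
        simp [P.idem, smul_comm c d]
      exact (smul_eq_zero.mp h1).resolve_left hc0

/-- Some `obj i` is a retract of `P`, via `b` and `s`. This splits `P.p` into the orthogonal
idempotents `s ≫ b` and `P.p - s ≫ b`; the first is nonzero, so the second vanishes and the
retraction is an isomorphism. -/
theorem exists_iso_of_isIndecomposableIdempotent (h : IsSplitGeneratingFamily A e) {P : Karoubi C}
    (hP : IsIndecomposableIdempotent P.p) : ∃ i, Nonempty (P ≅ h.obj i) := by
  have hid : 𝟙 P ≠ 0 := fun H => hP.2.1 (congrArg Karoubi.Hom.f H)
  obtain ⟨i, b, hb⟩ := h.exists_hom_comp_ne_zero hid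
  rw [Category.comp_id] at hb
  obtain ⟨s, hs⟩ := h.exists_retraction hb
  refine ⟨i, ⟨⟨s, b, ?_, hs⟩⟩⟩
  have hs' : b.f ≫ s.f = e i := congrArg Karoubi.Hom.f hs
  have hbe : e i ≫ b.f = b.f := Karoubi.p_comp b
  have hsb : (s.f ≫ b.f) ≫ s.f ≫ b.f = s.f ≫ b.f := by
    rw [Category.assoc, reassoc_of% hs', hbe]
  have hps : P.p ≫ s.f = s.f := Karoubi.p_comp s
  have hbp : b.f ≫ P.p = b.f := Karoubi.comp_p b
  rcases hP.2.2 (s.f ≫ b.f) (P.p - s.f ≫ b.f) hsb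
    (by simpa [Preadditive.sub_comp, Preadditive.comp_sub, P.idem, reassoc_of% hps, hbp,
        sub_eq_zero] using hsb.symm)
    (by simpa [Preadditive.comp_sub, hbp, sub_eq_zero] using hsb.symm)
    (by simpa [Preadditive.sub_comp, reassoc_of% hps, sub_eq_zero] using hsb.symm)
    (by abel) with h0 | h0
  -- If `s ≫ b = 0`, then `e i = (b ≫ s) ≫ (b ≫ s) = b ≫ (s ≫ b) ≫ s = 0`.
  · refine absurd ?_ (h.ne_zero i)
    rw [← h.idem i]
    nth_rw 1 [← hs']
    rw [← hs', Category.assoc, reassoc_of% h0]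
    simp
  · exact Karoubi.hom_ext _ _ (sub_eq_zero.mp h0).symm

theorem simple_iff (h : IsSplitGeneratingFamily A e) (P : Karoubi C) :
    Simple P ↔ IsIndecomposableIdempotent P.p := by
  constructor
  · intro _
    obtain ⟨i, ⟨φ⟩⟩ := h.exists_iso_of_simple P
    exact h.isIndecomposableIdempotent_of_iso φ
  · intro hP
    obtain ⟨i, ⟨φ⟩⟩ := h.exists_iso_of_isIndecomposableIdempotent hP
    have := h.simple_obj i
    exact Simple.of_iso φ

theorem eq_of_iso (h : IsSplitGeneratingFamily A e) {i j : ι} (φ : h.obj i ≅ h.obj j) : i = j :=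
  h.eq_of_hom_ne_zero (f := φ.hom) fun H => h.id_obj_ne_zero i (by
    rw [← φ.hom_inv_id, H, Limits.zero_comp])

end IsSplitGeneratingFamily

end SplitGenerators

theorem IsSplitGeneratingFamily.classifiesDefects {p : ℕ} [NeZero p] {M N : SkeletalBimodule p}
    {ι : Type} {A : ι → Ann M N} {e : ∀ i, A i ⟶ A i} (h : IsSplitGeneratingFamily A e) :
    ClassifiesDefects M N A e where
  idem := h.idem
  simple := h.simple_obj
  inequivalent _ _ := fun ⟨φ⟩ => h.eq_of_iso φ
  exhaustive P _ := h.exists_iso_of_simple P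
  simple_iff := h.simple_iff

/-- Serves to remove a `Unit` factor from the index type when there is one orbit or one character.
-/
theorem ClassifiesDefects.reindex {p : ℕ} [NeZero p] {M N : SkeletalBimodule p} {ι κ : Type}
    {A : ι → Ann M N} {e : ∀ i, A i ⟶ A i} (h : ClassifiesDefects M N A e) (ε : κ ≃ ι) :
    ClassifiesDefects M N (fun k => A (ε k)) (fun k => e (ε k)) where
  idem _ := h.idem _
  simple _ := h.simple _
  inequivalent _ _ hij := ε.injective (h.inequivalent _ _ hij)
  exhaustive P hP := by
    obtain ⟨i, hi⟩ := h.exhaustive P hP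
    obtain ⟨k, rfl⟩ := ε.surjective i
    exact ⟨k, hi⟩
  simple_iff := h.simple_iff

/-! ### Diagrams as a basis of a twisted action groupoid. -/

namespace Ann

section

variable {p : ℕ} {M N : SkeletalBimodule p}

theorem Composable.neg {X Y : Ann M N} {a : ZMod p × ZMod p} (h : Composable X Y a) :
    Composable Y X (-a) :=
  ⟨by rw [← h.1, M.act_act, neg_add_cancel, M.act_zero],
    by rw [← h.2, N.act_act, neg_add_cancel, N.act_zero]⟩

theorem phase_ne_zero (Y : Ann M N) (a b : ZMod p × ZMod p) : phase Y a b ≠ 0 :=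
  Units.ne_zero _

/-- The values at `h` and `-h` multiply, up to the phase, to `θ 0 = 1`. -/
theorem twist_ne_zero {H : Type*} [AddGroup H] {X : Ann M N} {σ : H → ZMod p × ZMod p} {θ : H → ℂ}
    (hθ : ∀ g h, θ g * θ h * phase X (σ g) (σ h) = θ (g + h)) (hθ0 : θ 0 = 1)
    (h : H) : θ h ≠ 0 := by
  intro H0
  have := hθ h (-h)
  simp [H0, hθ0] at this

variable [NeZero p]

/-- The coefficients of a morphism with respect to the annular diagrams. -/
def coeff (X Y : Ann M N) : (X ⟶ Y) →ₗ[ℂ] (ZMod p × ZMod p → ℂ) :=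
  (homSpace X Y).subtype

theorem coeff_injective (X Y : Ann M N) : Function.Injective (coeff X Y) :=
  Subtype.val_injective

theorem coeff_eq_zero {X Y : Ann M N} (f : X ⟶ Y) {a : ZMod p × ZMod p} (h : ¬ Composable X Y a) :
    coeff X Y f a = 0 :=
  Subtype.property (p := (· ∈ homSpace X Y)) f a h

theorem coeff_comp {X Y Z : Ann M N} (f : X ⟶ Y) (k : Y ⟶ Z) (c : ZMod p × ZMod p) :
    coeff X Z (f ≫ k) c =
      ∑ b : ZMod p × ZMod p, coeff X Y f (c - b) * coeff Y Z k b * phase Z (c - b) b := rfl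

theorem coeff_diagram {X Y : Ann M N} {b : ZMod p × ZMod p} (h : Composable X Y b)
    (a : ZMod p × ZMod p) : coeff X Y (diagram X Y b.1 b.2) a = if a = b then 1 else 0 := by
  classical
  change (if a = (b.1, b.2) ∧ Composable X Y a then (1 : ℂ) else 0) = _
  by_cases hab : a = b
  · subst hab
    simp [h]
  · simp [hab]

theorem diagram_comp {X Y Z : Ann M N} {a b : ZMod p × ZMod p} (ha : Composable X Y a)
    (hb : Composable Y Z b) : diagram X Y a.1 a.2 ≫ diagram Y Z b.1 b.2 =
      phase Z a b • diagram X Z (a + b).1 (a + b).2 := by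
  refine coeff_injective _ _ (funext fun c => ?_)
  rw [coeff_comp, map_smul, Pi.smul_apply, coeff_diagram (ha.add hb), Finset.sum_eq_single b]
  · rw [coeff_diagram ha, coeff_diagram hb]
    by_cases hc : c = a + b
    · simp [hc]
    · simp [hc, sub_eq_iff_eq_add]
  · intro d _ hd
    simp [coeff_diagram hb, hd]
  · simp

theorem diagram_zero (X : Ann M N) : diagram X X 0 0 = 𝟙 X := by
  refine coeff_injective _ _ (funext fun c => ?_)
  exact coeff_diagram (Composable.refl X) c

theorem eq_sum_diagram {X Y : Ann M N} (f : X ⟶ Y) :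
    f = ∑ a : ZMod p × ZMod p, coeff X Y f a • diagram X Y a.1 a.2 := by
  refine coeff_injective _ _ (funext fun c => ?_)
  rw [map_sum, Finset.sum_apply, Finset.sum_eq_single c]
  · by_cases hc : Composable X Y c
    · simp [coeff_diagram hc]
    · simp [coeff_eq_zero f hc]
  · intro b _ hb
    by_cases h : Composable X Y b
    · simp [coeff_diagram h, hb.symm]
    · simp [coeff_eq_zero f h]
  · simp

theorem hom_eq_zero {X Y : Ann M N} (h : ∀ a, ¬ Composable X Y a) (f : X ⟶ Y) : f = 0 :=
  coeff_injective _ _ (funext fun a => by rw [coeff_eq_zero f (h a), map_zero, Pi.zero_apply])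

/-- The diagram with reversed strings inverts a diagram up to a phase, so an identity factors
through any object of the same orbit. -/
theorem exists_factorization {X Y : Ann M N} {a : ZMod p × ZMod p} (h : Composable X Y a) :
    ∃ (u : X ⟶ Y) (v : Y ⟶ X), u ≫ v = 𝟙 X := by
  refine ⟨(phase X a (-a))⁻¹ • diagram X Y a.1 a.2, diagram Y X (-a).1 (-a).2, ?_⟩
  rw [Linear.smul_comp, diagram_comp h h.neg, smul_smul, inv_mul_cancel₀ (phase_ne_zero _ _ _)]
  simpa using diagram_zero X

end

/-! ### Character idempotents of a stabilizer with trivialized cocycle. -/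

section TwistedGroupAlgebra

variable {p : ℕ} [NeZero p] {M N : SkeletalBimodule p} {H : Type} [AddCommGroup H] [Fintype H]

/-- The idempotent of the twisted group algebra of the strings `σ h` attached to `θ`. -/
noncomputable def charIdem (X : Ann M N) (σ : H →+ ZMod p × ZMod p) (θ : H → ℂ) : X ⟶ X :=
  (1 / Fintype.card H : ℂ) • ∑ h, θ h • diagram X X (σ h).1 (σ h).2

variable {X : Ann M N} {σ : H →+ ZMod p × ZMod p} {θ θ' : H → ℂ}

/-- By `hθ` the elements `θ h • [σ h]` multiply as in the untwisted group, so each of them only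
translates the summation index of the average. -/
theorem charIdem_comp_diagram (hσ : ∀ h, Composable X X (σ h))
    (hθ : ∀ g h, θ g * θ h * phase X (σ g) (σ h) = θ (g + h)) (h : H) (hθ0 : θ h ≠ 0) :
    charIdem X σ θ ≫ diagram X X (σ h).1 (σ h).2 = (θ h)⁻¹ • charIdem X σ θ := by
  rw [charIdem, Linear.smul_comp, smul_comm (θ h)⁻¹]
  congr 1
  rw [Preadditive.sum_comp, Finset.smul_sum,
    ← Equiv.sum_comp (Equiv.addRight h) fun k => (θ h)⁻¹ • θ k • diagram X X (σ k).1 (σ k).2]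
  refine Finset.sum_congr rfl fun g _ => ?_
  rw [Linear.smul_comp, diagram_comp (hσ g) (hσ h), Equiv.coe_addRight, ← map_add, smul_smul,
    smul_smul, ← hθ g h]
  congr 1
  field_simp

/-- Each diagram of the second factor is absorbed by the first, which reduces products of
idempotents to a character sum. -/
theorem charIdem_comp_charIdem (hσ : ∀ h, Composable X X (σ h))
    (hθ : ∀ g h, θ g * θ h * phase X (σ g) (σ h) = θ (g + h)) (hθ0 : θ 0 = 1) :
    charIdem X σ θ ≫ charIdem X σ θ' =
      ((1 / Fintype.card H : ℂ) * ∑ h, θ' h * (θ h)⁻¹) • charIdem X σ θ := by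
  conv_lhs => rw [charIdem.eq_1 X σ θ']
  rw [Linear.comp_smul, Preadditive.comp_sum, mul_smul, Finset.sum_smul]
  congr 1
  refine Finset.sum_congr rfl fun h _ => ?_
  rw [Linear.comp_smul, charIdem_comp_diagram hσ hθ h (twist_ne_zero hθ hθ0 h), smul_smul]

/-- When `σ` covers the whole stabilizer, its diagrams span `End X`, and all of them are absorbed up
to scalars. This yields scalar corners and orthogonality over one object. -/
theorem exists_charIdem_comp_eq_smul (hσ : ∀ a, Composable X X a ↔ ∃ h, σ h = a)
    (hθ : ∀ g h, θ g * θ h * phase X (σ g) (σ h) = θ (g + h)) (hθ0 : θ 0 = 1) (f : X ⟶ X) :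
    ∃ c : ℂ, charIdem X σ θ ≫ f = c • charIdem X σ θ := by
  classical
  -- Outside the stabilizer `s` is arbitrary, which is harmless since the coefficient of `f`
  -- vanishes there.
  choose! s hs using fun a => (hσ a).mp
  refine ⟨∑ a, coeff X X f a * (θ (s a))⁻¹, ?_⟩
  nth_rw 1 [eq_sum_diagram f]
  rw [Preadditive.comp_sum, Finset.sum_smul]
  refine Finset.sum_congr rfl fun a _ => ?_
  by_cases ha : Composable X X a
  · have := charIdem_comp_diagram (fun h => (hσ _).mpr ⟨h, rfl⟩) hθ (s a)
      (twist_ne_zero hθ hθ0 _)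
    rw [hs a ha] at this
    rw [Linear.comp_smul, this, smul_smul]
  · simp [coeff_eq_zero f ha]

variable {ρ κ : Type} [Fintype κ]

/-- The stabilizers of all representatives `B r` of the orbits are the image of `σ`, and
the twisted group algebra of the stabilizer is trivialized by `t`. -/
theorem isSplitGeneratingFamily_charIdem (B : ρ → Ann M N) (σ : H →+ ZMod p × ZMod p)
    (hσ : Function.Injective σ) (t : H → ℂ) (χ : κ → AddChar H ℂ) (hχ : Function.Injective χ)
    (hcard : Fintype.card κ = Fintype.card H) (ht0 : t 0 = 1)
    (ht : ∀ r g h, t g * t h * phase (B r) (σ g) (σ h) = t (g + h))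
    (hB : ∀ r r' a, Composable (B r) (B r') a ↔ r = r' ∧ ∃ h, σ h = a)
    (orbit : ∀ Z, ∃ r a, Composable Z (B r) a) :
    IsSplitGeneratingFamily (fun i : ρ × κ => B i.1)
      (fun i => charIdem (B i.1) σ fun h => χ i.2 h * t h) := by
  classical
  have hH : (Fintype.card H : ℂ) ≠ 0 := Nat.cast_ne_zero.mpr Fintype.card_ne_zero
  have hstab : ∀ r a, Composable (B r) (B r) a ↔ ∃ h, σ h = a := fun r a => by simp [hB]
  have hstab' : ∀ r h, Composable (B r) (B r) (σ h) := fun r h => (hstab r _).mpr ⟨h, rfl⟩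
  have hθ : ∀ r x g h, (χ x g * t g) * (χ x h * t h) * phase (B r) (σ g) (σ h) =
      χ x (g + h) * t (g + h) := fun r x g h => by
    rw [← ht r, AddChar.map_add_eq_mul]
    ring
  have hθ0 : ∀ x, χ x 0 * t 0 = 1 := by simp [ht0]
  have htne : ∀ r h, t h ≠ 0 := fun r => twist_ne_zero (ht r) ht0
  -- The trivialization `t` cancels in the quotient, leaving the orthogonality relation for `χ y - χ
  -- x`, the additive notation for the quotient of characters.
  have mul : ∀ r x y, charIdem (B r) σ (fun h => χ x h * t h) ≫
      charIdem (B r) σ (fun h => χ y h * t h) =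
        if x = y then charIdem (B r) σ (fun h => χ x h * t h) else 0 := by
    intro r x y
    rw [charIdem_comp_charIdem (hstab' r) (hθ r x) (hθ0 x)]
    have : ∀ h, χ y h * t h * (χ x h * t h)⁻¹ = (χ y - χ x) h := fun h => by
      have := htne r h
      rw [AddChar.sub_apply', ← div_eq_mul_inv, mul_div_mul_right _ _ this]
    simp only [this]
    rw [AddChar.sum_eq_ite]
    by_cases hxy : x = y
    · simp [hxy, hH]
    · have : χ y - χ x ≠ 0 := sub_ne_zero.mpr fun H0 => hxy (hχ H0).symm
      simp [hxy, this]
  -- By counting, `χ` lists every character of `H`; this is what makes the idempotents sum to the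
  -- identity.
  have hbij : Function.Bijective χ :=
    (Fintype.bijective_iff_injective_and_card χ).mpr ⟨hχ, by rw [hcard, AddChar.card_eq]⟩
  have hsum : ∀ r, ∑ x, charIdem (B r) σ (fun h => χ x h * t h) = 𝟙 (B r) := by
    intro r
    simp only [charIdem]
    rw [← Finset.smul_sum, Finset.sum_comm, Finset.sum_eq_single 0]
    · simp [ht0, hcard, diagram_zero, ← Nat.cast_smul_eq_nsmul ℂ, smul_smul, hH]
    · intro h _ hh
      rw [← Finset.sum_smul, ← Finset.sum_mul, hbij.sum_comp (fun ψ => ψ h),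
        AddChar.sum_apply_eq_ite, if_neg hh, zero_mul, zero_smul]
    · simp
  constructor
  · rintro ⟨r, x⟩
    simp [mul]
  · rintro ⟨r, x⟩ h0
    -- The coefficient at trivial strings is `1 / |H|`: injectivity of `σ` leaves only the term `h =
    -- 0`.
    have := congrArg (fun f => coeff _ _ f 0) h0
    simp only [charIdem, map_smul, map_sum, Pi.smul_apply, Finset.sum_apply,
      coeff_diagram (hstab' r _), map_zero, Pi.zero_apply] at this
    rw [Finset.sum_eq_single 0 (fun h _ hh => by
      simp [(map_ne_zero_iff σ hσ).mpr hh |>.symm]) (by simp)] at this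
    simp [ht0, hH] at this
  · rintro ⟨r, x⟩ ⟨r', y⟩ hij f
    by_cases hr : r = r'
    · subst hr
      obtain ⟨c, hc⟩ := exists_charIdem_comp_eq_smul (hstab r) (hθ r x) (hθ0 x) f
      have hxy : x ≠ y := fun H0 => hij (by rw [H0])
      rw [← Category.assoc, hc, Linear.smul_comp, mul, if_neg hxy, smul_zero]
    · rw [hom_eq_zero (fun a ha => hr ((hB _ _ a).mp ha).1) f]
      simp
  · rintro ⟨r, x⟩ f
    obtain ⟨c, hc⟩ := exists_charIdem_comp_eq_smul (hstab r) (hθ r x) (hθ0 x) f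
    exact ⟨c, by rw [← Category.assoc, hc, Linear.smul_comp, mul, if_pos rfl]⟩
  · intro Z
    obtain ⟨r, a, ha⟩ := orbit Z
    obtain ⟨u, v, huv⟩ := exists_factorization ha
    -- Write `𝟙 Z = u ≫ 𝟙 (B r) ≫ v` and split the middle identity into the idempotents of all
    -- characters.
    rw [← huv, ← Category.id_comp v, ← hsum r, Preadditive.sum_comp, Preadditive.comp_sum]
    exact Submodule.sum_mem _ fun x _ => Submodule.subset_span ⟨(r, x), u, v, rfl⟩

end TwistedGroupAlgebra


/-! ### Criteria for trivial, cyclic and full stabilizers. -/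

/-- The case `H = Unit`: one idempotent per orbit, the identity diagram. `rep Z` names the orbit of
`Z`, and `str Z` carries its representative to `Z`. -/
theorem classifiesDefects_of_free {p : ℕ} [NeZero p] {M N : SkeletalBimodule p} {ρ : Type}
    (B : ρ → Ann M N) (rep : Ann M N → ρ) (str : Ann M N → ZMod p × ZMod p)
    (orbit : ∀ Z, Composable Z (B (rep Z)) (str Z))
    (hB : ∀ r r' a, Composable (B r) (B r') a ↔ r = r' ∧ a.1 = 0 ∧ a.2 = 0) :
    ClassifiesDefects M N B (fun _ => diagram _ _ 0 0) := by
  have h := (isSplitGeneratingFamily_charIdem (κ := Unit) (H := Unit) B 0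
    (Function.injective_of_subsingleton _) 1 (fun _ => 1) (Function.injective_of_subsingleton _) rfl
    rfl (fun r g h => by simp [phase_zero_left]) (fun r r' a => by simp [hB, Prod.ext_iff, eq_comm])
    fun Z => ⟨_, _, orbit Z⟩).classifiesDefects.reindex (Equiv.prodPUnit ρ).symm
  have key : (fun r => diagram (B r) (B r) 0 0) = fun r =>
      charIdem (B r) (0 : Unit →+ ZMod p × ZMod p) fun h => (1 : AddChar Unit ℂ) h * 1 := by
    funext r
    simp [charIdem]
  rw [key]
  exact h

section

variable {p : ℕ} {M N : SkeletalBimodule p}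

theorem phase_eq (Y : Ann M N) (a b : ZMod p × ZMod p) :
    phase Y a b = (M.assoc a b Y.fst : ℂ) * (N.assoc a b Y.snd : ℂ)⁻¹ := by
  simp [phase]

open Wall

theorem assoc_L (a b : ZMod p × ZMod p) (m : (L p).Obj) : (L p).assoc a b m = 1 := by
  simp [SkeletalBimodule.assoc]

theorem assoc_R (a b : ZMod p × ZMod p) (m : (R p).Obj) : (R p).assoc a b m = 1 := by
  simp [SkeletalBimodule.assoc]

theorem assoc_X (k : ZMod p) (a b : ZMod p × ZMod p) (m : (X k).Obj) : (X k).assoc a b m = 1 := by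
  simp [SkeletalBimodule.assoc]

end

section

variable {p : ℕ} [Fact p.Prime]

/-- The character `h ↦ ω ^ (h x)`. -/
noncomputable def cyclicChar (x : ZMod p) : AddChar (ZMod p) ℂ :=
  AddChar.mulShift ZMod.stdAddChar x

theorem cyclicChar_apply (x h : ZMod p) : cyclicChar x h = ω (h * x) := by
  rw [cyclicChar, AddChar.mulShift_apply, mul_comm, ω]

theorem cyclicChar_injective : Function.Injective (cyclicChar (p := p)) :=
  AddChar.to_mulShift_inj_of_isPrimitive (ZMod.isPrimitive_stdAddChar p)

theorem ω_zero : ω (0 : ZMod p) = 1 := AddChar.map_zero_eq_one _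

theorem ω_add (x y : ZMod p) : ω (x + y) = ω x * ω y := AddChar.map_add_eq_mul _ _ _

theorem ω_neg (x : ZMod p) : ω (-x) = (ω x)⁻¹ := AddChar.map_neg_eq_inv _ _

theorem ω_ne_zero (x : ZMod p) : ω x ≠ 0 := by
  intro h
  have := ω_add x (-x)
  simp [h, ω_zero] at this

variable {M N : SkeletalBimodule p}

/-- Here the stabilizer is the line through `(u, v)`, given by the equation in `hB` and parametrized
by `g ↦ (u g, v g)`; `t` trivializes the cocycle along it. -/
theorem classifiesDefects_of_cyclic {ρ : Type} (B : ρ → Ann M N) (u v : ZMod p)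
    (huv : u ≠ 0 ∨ v ≠ 0) (t : ZMod p → ℂ) (ht0 : t 0 = 1)
    (ht : ∀ r g h, t g * t h * phase (B r) (u * g, v * g) (u * h, v * h) = t (g + h))
    (rep : Ann M N → ρ) (str : Ann M N → ZMod p × ZMod p)
    (orbit : ∀ Z, Composable Z (B (rep Z)) (str Z))
    (hB : ∀ r r' a, Composable (B r) (B r') a ↔ r = r' ∧ v * a.1 = u * a.2)
    (e : ∀ i : ρ × ZMod p, B i.1 ⟶ B i.1)
    (he : ∀ i, e i = (1 / p : ℂ) • ∑ g, (ω (g * i.2) * t g) • diagram _ _ (u * g) (v * g)) :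
    ClassifiesDefects M N (fun i : ρ × ZMod p => B i.1) e := by
  have h := (isSplitGeneratingFamily_charIdem B
    ((AddMonoidHom.mulLeft u).prod (AddMonoidHom.mulLeft v)) ?_ t cyclicChar cyclicChar_injective
    rfl ht0 ht ?_ fun Z => ⟨_, _, orbit Z⟩).classifiesDefects
  · convert h using 2 with i
    rw [he, charIdem, ZMod.card]
    simp only [cyclicChar_apply]
    rfl
  · intro g h hgh
    obtain ⟨h1, h2⟩ := Prod.mk.inj hgh
    exact huv.elim (fun hu => mul_left_cancel₀ hu h1) fun hv => mul_left_cancel₀ hv h2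
  · rintro r r' ⟨a, b⟩
    rw [hB]
    refine and_congr_right fun _ => ⟨fun h => ?_, ?_⟩
    -- The parameter of a point of the line is read off from whichever coordinate of `(u, v)` is
    -- invertible.
    · rcases huv with hu | hv
      · exact ⟨u⁻¹ * a, Prod.ext (mul_inv_cancel_left₀ hu a) (mul_left_cancel₀ hu (by
          simpa [mul_left_comm v, mul_inv_cancel_left₀ hu] using h))⟩
      · exact ⟨v⁻¹ * b, Prod.ext (mul_left_cancel₀ hv (by
          simpa [mul_left_comm u, mul_inv_cancel_left₀ hv] using h.symm))
          (mul_inv_cancel_left₀ hv b)⟩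
    · rintro ⟨g, hg⟩
      obtain ⟨rfl, rfl⟩ := Prod.mk.inj hg
      exact mul_left_comm _ _ _

theorem classifiesDefects_of_transitive_cyclic (B : Ann M N) (u v : ZMod p)
    (huv : u ≠ 0 ∨ v ≠ 0) (t : ZMod p → ℂ) (ht0 : t 0 = 1)
    (ht : ∀ g h, t g * t h * phase B (u * g, v * g) (u * h, v * h) = t (g + h))
    (str : Ann M N → ZMod p × ZMod p) (orbit : ∀ Z, Composable Z B (str Z))
    (hB : ∀ a, Composable B B a ↔ v * a.1 = u * a.2) (e : ZMod p → (B ⟶ B))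
    (he : ∀ x, e x = (1 / p : ℂ) • ∑ g, (ω (g * x) * t g) • diagram _ _ (u * g) (v * g)) :
    ClassifiesDefects M N (fun _ : ZMod p => B) e :=
  (classifiesDefects_of_cyclic (fun _ : Unit => B) u v huv t ht0 (fun _ => ht) (fun _ => ())
    str orbit (by simpa using hB) (fun i => e i.2) (fun i => he i.2)).reindex (Equiv.punitProd _).symm

/-- The character `(g, h) ↦ ω ^ (g x + h y)`. -/
noncomputable def bicyclicChar (i : ZMod p × ZMod p) : AddChar (ZMod p × ZMod p) ℂ where
  toFun a := ω (a.1 * i.1 + a.2 * i.2)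
  map_zero_eq_one' := by simp [ω_zero]
  map_add_eq_mul' a b := by
    rw [← ω_add]
    congr 1
    simp only [Prod.fst_add, Prod.snd_add]
    ring

theorem bicyclicChar_apply (i a : ZMod p × ZMod p) :
    bicyclicChar i a = ω (a.1 * i.1 + a.2 * i.2) := rfl

theorem bicyclicChar_injective : Function.Injective (bicyclicChar (p := p)) := by
  intro i j hij
  refine Prod.ext (cyclicChar_injective (DFunLike.ext _ _ fun h => ?_))
    (cyclicChar_injective (DFunLike.ext _ _ fun h => ?_))
  · simpa [cyclicChar_apply, bicyclicChar_apply] using DFunLike.congr_fun hij (h, 0)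
  · simpa [cyclicChar_apply, bicyclicChar_apply] using DFunLike.congr_fun hij (0, h)

theorem classifiesDefects_of_trivial_action (B : Ann M N)
    (hphase : ∀ g h, phase B g h = 1) (hB : ∀ Y Z : Ann M N, ∀ a, Composable Y Z a) :
    ClassifiesDefects M N (fun _ : ZMod p × ZMod p => B)
      (fun i => (1 / (p : ℂ) ^ 2) • ∑ g : ZMod p, ∑ h : ZMod p,
        ω (g * i.1 + h * i.2) • diagram _ _ g (-h)) := by
  have h := (isSplitGeneratingFamily_charIdem (fun _ : Unit => B)
    -- The stabilizer is parametrized by `(g, h) ↦ (g, -h)` to match the sign convention of the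
    -- listed idempotents.
    ((AddMonoidHom.fst (ZMod p) (ZMod p)).prod (-AddMonoidHom.snd (ZMod p) (ZMod p))) ?_ 1
    bicyclicChar bicyclicChar_injective rfl rfl (fun r g h => by simp [hphase])
    (fun r r' a => ?_)
    (fun Z => ⟨(), 0, hB _ _ _⟩)).classifiesDefects.reindex (Equiv.punitProd _).symm
  · convert h using 2 with i
    simp [charIdem, Fintype.sum_prod_type, bicyclicChar_apply, pow_two]
  · rintro ⟨g, h⟩ ⟨g', h'⟩ hgh
    simpa using hgh
  · exact ⟨fun _ => ⟨rfl, (a.1, -a.2), by simp⟩, fun _ => hB _ _ _⟩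

theorem ω_two : ω (1 : ZMod 2) = -1 := by
  have := ZMod.stdAddChar_coe (N := 2) 1
  rw [ω]
  norm_num at this
  rw [this, ← Complex.exp_pi_mul_I]
  congr 1
  ring

theorem zmod_two_cases (g : ZMod 2) : g = 0 ∨ g = 1 := by
  revert g
  decide

/-- Separates the label `x` as a character, so that only `Θ 0 a` has to trivialize a cocycle. -/
theorem Θ_eq (x a g : ZMod p) : Θ x a g = ω (g * x) * Θ 0 a g := by
  unfold Θ
  split_ifs with hp
  · subst hp
    have h2 : ∀ g x : ZMod 2, ω (g * x) = (-1) ^ (g.val * x.val) := by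
      intro g x
      rcases zmod_two_cases g with rfl | rfl <;> rcases zmod_two_cases x with rfl | rfl <;>
        simp [ω_zero, ω_two, ZMod.val_one]
    rw [h2]
    simp
  · rw [← ω_add]
    congr 1
    ring

theorem Θ_zero (a : ZMod p) : Θ 0 a 0 = 1 := by
  simp [Θ, ω_zero]

/-- `Θ 0 a` is a quadratic refinement of the bilinear form `a g h`: for odd `p`, the form `a g² / 2`
polarizes to it. For `p = 2` one cannot halve, and `i`, a square root of `ω = -1`, takes over. -/
theorem Θ_mul (a g h : ZMod p) : Θ 0 a g * Θ 0 a h * ω (a * g * h) = Θ 0 a (g + h) := by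
  unfold Θ
  split_ifs with hp
  · subst hp
    rcases zmod_two_cases a with rfl | rfl <;> rcases zmod_two_cases g with rfl | rfl <;>
      rcases zmod_two_cases h with rfl | rfl <;>
      simp [ω_zero, ω_two, ZMod.val_one, show (1 + 1 : ZMod 2) = 0 from rfl]
  · have h2 : (2 : ZMod p) ≠ 0 := by
      have : ((2 : ℕ) : ZMod p) ≠ 0 := by
        rw [Ne, ZMod.natCast_eq_zero_iff, Nat.prime_dvd_prime_iff_eq Fact.out Nat.prime_two]
        exact hp
      simpa using this
    rw [← ω_add, ← ω_add]
    congr 1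
    field_simp
    ring

open Wall in
-- Only the middle associator contributes, from the outer left string passing the inner right
-- string.
theorem assoc_F (q : ZMod p) (a b : ZMod p × ZMod p) (m : (F q).Obj) :
    ((F q).assoc a b m : ℂ) = ω (q * a.1 * b.2) := by
  simp [SkeletalBimodule.assoc, ω, ZMod.stdAddChar_apply]

end

end Ann

namespace Wall

open Ann

variable {p : ℕ} [Fact p.Prime]

/-! ### Pairs on which the strings act freely. -/

theorem classifiesDefects_T_T :
    ClassifiesDefects (T p) (T p) (fun i : ZMod p × ZMod p => ⟨(0, 0), (i.1, i.2)⟩)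
      (fun _ => diagram _ _ 0 0) := by
  refine classifiesDefects_of_free _ (fun Z => (Z.snd.1 - Z.fst.1, Z.snd.2 - Z.fst.2))
    (fun Z => Z.fst) ?_ ?_
  · rintro ⟨m, n⟩
    simp [Composable, SkeletalBimodule.act]
  · simp [Composable, SkeletalBimodule.act, Prod.ext_iff]
    grind

theorem classifiesDefects_T_L :
    ClassifiesDefects (T p) (L p) (fun a : ZMod p => ⟨(0, 0), a⟩) (fun _ => diagram _ _ 0 0) := by
  refine classifiesDefects_of_free _ (fun Z => Z.snd - Z.fst.2) (fun Z => Z.fst) ?_ ?_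
  · rintro ⟨m, n⟩
    simp [Composable, SkeletalBimodule.act]
  · simp [Composable, SkeletalBimodule.act, Prod.ext_iff]
    grind

theorem classifiesDefects_T_R :
    ClassifiesDefects (T p) (R p) (fun a : ZMod p => ⟨(0, 0), a⟩) (fun _ => diagram _ _ 0 0) := by
  refine classifiesDefects_of_free _ (fun Z => Z.snd - Z.fst.1) (fun Z => Z.fst) ?_ ?_
  · rintro ⟨m, n⟩
    simp [Composable, SkeletalBimodule.act]
  · simp [Composable, SkeletalBimodule.act, Prod.ext_iff]
    grind

theorem classifiesDefects_T_X (l : ZMod p) :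
    ClassifiesDefects (T p) (X l) (fun a : ZMod p => ⟨(0, 0), a⟩) (fun _ => diagram _ _ 0 0) := by
  -- The label in `T` determines the strings, and what remains is the orbit invariant `n - m₁ - l
  -- m₂`.
  refine classifiesDefects_of_free _ (fun Z => Z.snd - Z.fst.1 - l * Z.fst.2) (fun Z => Z.fst) ?_ ?_
  · rintro ⟨m, n⟩
    simp [Composable, SkeletalBimodule.act]
    grind
  · simp [Composable, SkeletalBimodule.act, Prod.ext_iff]
    grind

theorem classifiesDefects_T_F (q : ZMod p) :
    ClassifiesDefects (T p) (F q) (fun _ : Unit => ⟨(0, 0), ()⟩) (fun _ => diagram _ _ 0 0) := by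
  refine classifiesDefects_of_free _ (fun Z => ()) (fun Z => Z.fst) ?_ ?_
  · rintro ⟨m, n⟩
    simp [Composable, SkeletalBimodule.act]
  · simp [Composable, SkeletalBimodule.act, Prod.ext_iff]

theorem classifiesDefects_L_T :
    ClassifiesDefects (L p) (T p) (fun a : ZMod p => ⟨0, (0, a)⟩) (fun _ => diagram _ _ 0 0) := by
  refine classifiesDefects_of_free _ (fun Z => Z.snd.2 - Z.fst) (fun Z => (Z.snd.1, Z.fst)) ?_ ?_
  · rintro ⟨m, n⟩
    simp [Composable, SkeletalBimodule.act]
  · simp [Composable, SkeletalBimodule.act, Prod.ext_iff]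
    grind

/-- `L` sees only the right string and `R` only the left one, so the strings act simply transitively
on pairs. -/
theorem classifiesDefects_L_R :
    ClassifiesDefects (L p) (R p) (fun _ : Unit => ⟨0, 0⟩) (fun _ => diagram _ _ 0 0) := by
  refine classifiesDefects_of_free _ (fun Z => ()) (fun Z => (Z.snd, Z.fst)) ?_ ?_
  · rintro ⟨m, n⟩
    simp [Composable, SkeletalBimodule.act]
  · simp [Composable, SkeletalBimodule.act]
    grind

theorem classifiesDefects_L_X (l : ZMod p) :
    ClassifiesDefects (L p) (X l) (fun _ : Unit => ⟨0, 0⟩) (fun _ => diagram _ _ 0 0) := by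
  refine classifiesDefects_of_free _ (fun Z => ()) (fun Z => (Z.snd - l * Z.fst, Z.fst)) ?_ ?_
  · rintro ⟨m, n⟩
    simp [Composable, SkeletalBimodule.act]
  · simp [Composable, SkeletalBimodule.act]
    grind

theorem classifiesDefects_R_T :
    ClassifiesDefects (R p) (T p) (fun a : ZMod p => ⟨0, (a, 0)⟩) (fun _ => diagram _ _ 0 0) := by
  refine classifiesDefects_of_free _ (fun Z => Z.snd.1 - Z.fst) (fun Z => (Z.fst, Z.snd.2)) ?_ ?_
  · rintro ⟨m, n⟩
    simp [Composable, SkeletalBimodule.act]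
  · simp [Composable, SkeletalBimodule.act, Prod.ext_iff]
    grind

theorem classifiesDefects_R_L :
    ClassifiesDefects (R p) (L p) (fun _ : Unit => ⟨0, 0⟩) (fun _ => diagram _ _ 0 0) := by
  refine classifiesDefects_of_free _ (fun Z => ()) (fun Z => (Z.fst, Z.snd)) ?_ ?_
  · rintro ⟨m, n⟩
    simp [Composable, SkeletalBimodule.act]
  · simp [Composable, SkeletalBimodule.act]

theorem classifiesDefects_R_X {l : ZMod p} (hl : l ≠ 0) :
    ClassifiesDefects (R p) (X l) (fun _ : Unit => ⟨0, 0⟩) (fun _ => diagram _ _ 0 0) := by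
  refine classifiesDefects_of_free _ (fun Z => ()) (fun Z => (Z.fst, l⁻¹ * (Z.snd - Z.fst))) ?_ ?_
  · rintro ⟨m, n⟩
    simp [Composable, SkeletalBimodule.act]
    grind
  · simp [Composable, SkeletalBimodule.act]
    grind

theorem classifiesDefects_F_T (q : ZMod p) :
    ClassifiesDefects (F q) (T p) (fun _ : Unit => ⟨(), (0, 0)⟩) (fun _ => diagram _ _ 0 0) := by
  refine classifiesDefects_of_free _ (fun Z => ()) (fun Z => Z.snd) ?_ ?_
  · rintro ⟨m, n⟩
    simp [Composable, SkeletalBimodule.act]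
  · simp [Composable, SkeletalBimodule.act, Prod.ext_iff]

theorem classifiesDefects_X_T (k : ZMod p) :
    ClassifiesDefects (X k) (T p) (fun a : ZMod p => ⟨0, (a, 0)⟩) (fun _ => diagram _ _ 0 0) := by
  refine classifiesDefects_of_free _ (fun Z => Z.snd.1 - Z.fst + k * Z.snd.2)
    (fun Z => (Z.fst - k * Z.snd.2, Z.snd.2)) ?_ ?_
  · rintro ⟨m, n⟩
    simp [Composable, SkeletalBimodule.act]
  · simp [Composable, SkeletalBimodule.act, Prod.ext_iff]
    grind

theorem classifiesDefects_X_L (k : ZMod p) :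
    ClassifiesDefects (X k) (L p) (fun _ : Unit => ⟨0, 0⟩) (fun _ => diagram _ _ 0 0) := by
  refine classifiesDefects_of_free _ (fun Z => ()) (fun Z => (Z.fst - k * Z.snd, Z.snd)) ?_ ?_
  · rintro ⟨m, n⟩
    simp [Composable, SkeletalBimodule.act]
  · simp [Composable, SkeletalBimodule.act]

theorem classifiesDefects_X_R {k : ZMod p} (hk : k ≠ 0) :
    ClassifiesDefects (X k) (R p) (fun _ : Unit => ⟨0, 0⟩) (fun _ => diagram _ _ 0 0) := by
  refine classifiesDefects_of_free _ (fun Z => ()) (fun Z => (Z.snd, k⁻¹ * (Z.fst - Z.snd))) ?_ ?_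
  · rintro ⟨m, n⟩
    simp [Composable, SkeletalBimodule.act]
    grind
  · simp [Composable, SkeletalBimodule.act]
    grind

theorem classifiesDefects_X_X_of_ne {k l : ZMod p} (hkl : k ≠ l) :
    ClassifiesDefects (X k) (X l) (fun _ : Unit => ⟨0, 0⟩) (fun _ => diagram _ _ 0 0) := by
  refine classifiesDefects_of_free _ (fun Z => ())
    -- The unique solution of `g + k h = m`, `g + l h = n`, whose determinant is nonzero because `k
    -- ≠ l`.
    (fun Z => (Z.fst - k * ((k - l)⁻¹ * (Z.fst - Z.snd)), (k - l)⁻¹ * (Z.fst - Z.snd))) ?_ ?_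
  · rintro ⟨m, n⟩
    simp [Composable, SkeletalBimodule.act]
    grind
  · simp [Composable, SkeletalBimodule.act]
    grind

/-! ### Pairs with nontrivial stabilizer and trivializable cocycle. -/

theorem classifiesDefects_L_L :
    ClassifiesDefects (L p) (L p) (fun i : ZMod p × ZMod p => ⟨0, i.1⟩)
      (fun i => (1 / p : ℂ) • ∑ g : ZMod p, ω (g * i.2) • diagram _ _ g 0) := by
  refine classifiesDefects_of_cyclic (fun a : ZMod p => (⟨0, a⟩ : Ann (L p) (L p))) 1 0 (by simp)
    (fun _ => 1) rfl (fun _ g h => ?_) (fun Z => Z.snd - Z.fst) (fun Z => (0, Z.fst)) ?_ ?_ _ fun i => ?_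
  · simp [phase_eq, assoc_L]
  · rintro ⟨m, n⟩
    simp [Composable, SkeletalBimodule.act]
  · simp [Composable, SkeletalBimodule.act]
    grind
  · simp

theorem classifiesDefects_R_R :
    ClassifiesDefects (R p) (R p) (fun i : ZMod p × ZMod p => ⟨0, i.1⟩)
      (fun i => (1 / p : ℂ) • ∑ g : ZMod p, ω (g * i.2) • diagram _ _ 0 (-g)) := by
  refine classifiesDefects_of_cyclic (fun a : ZMod p => (⟨0, a⟩ : Ann (R p) (R p))) 0 (-1) (by simp)
    (fun _ => 1) rfl (fun _ g h => ?_) (fun Z => Z.snd - Z.fst) (fun Z => (Z.fst, 0)) ?_ ?_ _ fun i => ?_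
  · simp [phase_eq, assoc_R]
  · rintro ⟨m, n⟩
    simp [Composable, SkeletalBimodule.act]
  · simp [Composable, SkeletalBimodule.act]
    grind
  · simp

theorem classifiesDefects_X_X (k : ZMod p) :
    ClassifiesDefects (X k) (X k) (fun i : ZMod p × ZMod p => ⟨0, i.1⟩)
      (fun i => (1 / p : ℂ) • ∑ g : ZMod p, ω (g * i.2) • diagram _ _ (k * g) (-g)) := by
  refine classifiesDefects_of_cyclic (fun a : ZMod p => (⟨0, a⟩ : Ann (X k) (X k))) k (-1) (by simp)
    (fun _ => 1) rfl (fun _ g h => ?_) (fun Z => Z.snd - Z.fst) (fun Z => (Z.fst, 0)) ?_ ?_ _ fun i => ?_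
  · simp [phase_eq, assoc_X]
  · rintro ⟨m, n⟩
    simp [Composable, SkeletalBimodule.act]
  · simp [Composable, SkeletalBimodule.act]
    grind
  · simp

/-- The right string is zero along the stabilizer, so the middle associator of `F_q` is invisible.
-/
theorem classifiesDefects_L_F (q : ZMod p) :
    ClassifiesDefects (L p) (F q) (fun _ : ZMod p => ⟨0, ()⟩)
      (fun x => (1 / p : ℂ) • ∑ g : ZMod p, ω (g * x) • diagram _ _ g 0) := by
  refine classifiesDefects_of_transitive_cyclic _ 1 0 (by simp) (fun _ => 1) rfl
    (fun g h => ?_) (fun Z => (0, Z.fst)) ?_ ?_ _ fun x => ?_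
  · simp [phase_eq, assoc_L, assoc_F, ω_zero]
  · rintro ⟨m, n⟩
    simp [Composable, SkeletalBimodule.act]
  · simp [Composable, SkeletalBimodule.act]
    grind
  · simp

theorem classifiesDefects_R_F (q : ZMod p) :
    ClassifiesDefects (R p) (F q) (fun _ : ZMod p => ⟨0, ()⟩)
      (fun x => (1 / p : ℂ) • ∑ g : ZMod p, ω (g * x) • diagram _ _ 0 (-g)) := by
  refine classifiesDefects_of_transitive_cyclic _ 0 (-1) (by simp) (fun _ => 1) rfl
    (fun g h => ?_) (fun Z => (Z.fst, 0)) ?_ ?_ _ fun x => ?_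
  · simp [phase_eq, assoc_R, assoc_F, ω_zero]
  · rintro ⟨m, n⟩
    simp [Composable, SkeletalBimodule.act]
  · simp [Composable, SkeletalBimodule.act]
  · simp

theorem classifiesDefects_F_L (q : ZMod p) :
    ClassifiesDefects (F q) (L p) (fun _ : ZMod p => ⟨(), 0⟩)
      (fun x => (1 / p : ℂ) • ∑ g : ZMod p, ω (g * x) • diagram _ _ g 0) := by
  refine classifiesDefects_of_transitive_cyclic _ 1 0 (by simp) (fun _ => 1) rfl
    (fun g h => ?_) (fun Z => (0, Z.snd)) ?_ ?_ _ fun x => ?_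
  · simp [phase_eq, assoc_L, assoc_F, ω_zero]
  · rintro ⟨m, n⟩
    simp [Composable, SkeletalBimodule.act]
  · simp [Composable, SkeletalBimodule.act]
    grind
  · simp

theorem classifiesDefects_F_R (q : ZMod p) :
    ClassifiesDefects (F q) (R p) (fun _ : ZMod p => ⟨(), 0⟩)
      (fun x => (1 / p : ℂ) • ∑ g : ZMod p, ω (g * x) • diagram _ _ 0 (-g)) := by
  refine classifiesDefects_of_transitive_cyclic _ 0 (-1) (by simp) (fun _ => 1) rfl
    (fun g h => ?_) (fun Z => (Z.snd, 0)) ?_ ?_ _ fun x => ?_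
  · simp [phase_eq, assoc_R, assoc_F, ω_zero]
  · rintro ⟨m, n⟩
    simp [Composable, SkeletalBimodule.act]
  · simp [Composable, SkeletalBimodule.act]
  · simp

theorem classifiesDefects_F_zero_X {l : ZMod p} (hl : l ≠ 0) :
    ClassifiesDefects (F 0) (X l) (fun _ : ZMod p => ⟨(), 0⟩)
      (fun x => (1 / p : ℂ) • ∑ g : ZMod p, ω (g * x) • diagram _ _ g (-l⁻¹ * g)) := by
  refine classifiesDefects_of_transitive_cyclic _ 1 (-l⁻¹) (by simp) (fun _ => 1) rfl
    (fun g h => ?_) (fun Z => (Z.snd, 0)) ?_ ?_ _ fun x => ?_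
  · simp [phase_eq, assoc_X, assoc_F, ω_zero]
  · rintro ⟨m, n⟩
    simp [Composable, SkeletalBimodule.act]
  · simp [Composable, SkeletalBimodule.act]
    grind
  · simp

theorem classifiesDefects_X_F_zero {k : ZMod p} (hk : k ≠ 0) :
    ClassifiesDefects (X k) (F 0) (fun _ : ZMod p => ⟨0, ()⟩)
      (fun x => (1 / p : ℂ) • ∑ g : ZMod p, ω (g * x) • diagram _ _ g (-k⁻¹ * g)) := by
  refine classifiesDefects_of_transitive_cyclic _ 1 (-k⁻¹) (by simp) (fun _ => 1) rfl
    (fun g h => ?_) (fun Z => (Z.fst, 0)) ?_ ?_ _ fun x => ?_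
  · simp [phase_eq, assoc_X, assoc_F, ω_zero]
  · rintro ⟨m, n⟩
    simp [Composable, SkeletalBimodule.act]
  · simp [Composable, SkeletalBimodule.act]
    grind
  · simp

/-- Along the line `g + k h = 0`, spanned by `(k, -1)`, the inverse associator of `F_r` is
`ω^{krgh}`, which `Θ 0 (k * r)` trivializes. -/
theorem classifiesDefects_X_F (k r : ZMod p) :
    ClassifiesDefects (X k) (F r) (fun _ : ZMod p => ⟨0, ()⟩)
      (fun x => (1 / p : ℂ) • ∑ g : ZMod p, Θ x (k * r) g • diagram _ _ (k * g) (-g)) := by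
  refine classifiesDefects_of_transitive_cyclic _ k (-1) (by simp) (Θ 0 (k * r)) (Θ_zero _)
    (fun g h => ?_) (fun Z => (Z.fst, 0)) ?_ ?_ _ fun x => ?_
  · rw [← Θ_mul, phase_eq, assoc_X, assoc_F, Units.val_one, one_mul, ← ω_neg]
    ring_nf
  · rintro ⟨m, n⟩
    simp [Composable, SkeletalBimodule.act]
  · simp [Composable, SkeletalBimodule.act]
    grind
  · simp [← Θ_eq]

/-- As for `X_k`–`F_r`, but the associator of `F_q` now enters uninverted, whence the parameter `-(q
* l)`. -/
theorem classifiesDefects_F_X (q l : ZMod p) :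
    ClassifiesDefects (F q) (X l) (fun _ : ZMod p => ⟨(), 0⟩)
      (fun x => (1 / p : ℂ) • ∑ g : ZMod p, Θ x (-(q * l)) g • diagram _ _ (l * g) (-g)) := by
  refine classifiesDefects_of_transitive_cyclic _ l (-1) (by simp) (Θ 0 (-(q * l))) (Θ_zero _)
    (fun g h => ?_) (fun Z => (Z.snd, 0)) ?_ ?_ _ fun x => ?_
  · rw [← Θ_mul, phase_eq, assoc_X, assoc_F, Units.val_one, inv_one, mul_one]
    ring_nf
  · rintro ⟨m, n⟩
    simp [Composable, SkeletalBimodule.act]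
  · simp [Composable, SkeletalBimodule.act]
    grind
  · simp [← Θ_eq]

/-- The equal middle associators of the two sides cancel in the phase. -/
theorem classifiesDefects_F_F (q : ZMod p) :
    ClassifiesDefects (F q) (F q) (fun _ : ZMod p × ZMod p => ⟨(), ()⟩)
      (fun i => (1 / (p : ℂ) ^ 2) • ∑ g : ZMod p, ∑ h : ZMod p,
        ω (g * i.1 + h * i.2) • diagram _ _ g (-h)) :=
  classifiesDefects_of_trivial_action _
    (fun g h => by rw [phase_eq, assoc_F, mul_inv_cancel₀ (ω_ne_zero _)])
    fun _ _ _ => ⟨rfl, rfl⟩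


/-! ### The `F_q`–`F_r` annular algebra and Pauli matrices. -/

/-- The annular diagram `[g, h]` with both labels `Y`, as an element of the algebra `End Y`. -/
@[reducible] noncomputable def endDiagram {M N : SkeletalBimodule p} (Y : Ann M N) (g h : ZMod p) :
    End Y := diagram Y Y g h

/-- Multiplication in `End` reverses composition, so the right factor `b` is the outer diagram and
the phase involves `b.1` and `a.2`. -/
theorem endDiagram_mul_F (q r : ZMod p) (a b : ZMod p × ZMod p) :
    endDiagram (⟨(), ()⟩ : Ann (F q) (F r)) a.1 a.2 *
      endDiagram (⟨(), ()⟩ : Ann (F q) (F r)) b.1 b.2 =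
      ω ((q - r) * a.2 * b.1) •
        endDiagram (⟨(), ()⟩ : Ann (F q) (F r)) (a + b).1 (a + b).2 := by
  rw [End.mul_def, diagram_comp ⟨rfl, rfl⟩ ⟨rfl, rfl⟩, phase_eq, assoc_F, assoc_F, ← ω_neg, ← ω_add,
    add_comm b a]
  congr 2
  ring

theorem sum_ω_mul (x : ZMod p) : ∑ g : ZMod p, ω (g * x) = if x = 0 then (p : ℂ) else 0 := by
  have := AddChar.sum_mulShift x (ZMod.isPrimitive_stdAddChar p)
  simpa only [ω, ZMod.card, Nat.cast_ite, Nat.cast_zero] using this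

/-- The matrix `X ^ (s a₁) Z ^ a₂`. -/
noncomputable def weyl (s : ZMod p) (a : ZMod p × ZMod p) : Matrix (ZMod p) (ZMod p) ℂ :=
  Matrix.of fun i j => if i = j + s * a.1 then ω (j * a.2) else 0

theorem weyl_apply (s : ZMod p) (a : ZMod p × ZMod p) (i j : ZMod p) :
    weyl s a i j = if i = j + s * a.1 then ω (j * a.2) else 0 := rfl

theorem pauliX_pow (n : ℕ) (i j : ZMod p) :
    (pauliX p ^ n) i j = if i = j + n then 1 else 0 := by
  induction n generalizing i with
  | zero => simp [Matrix.one_apply]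
  | succ n ih =>
    rw [pow_succ', Matrix.mul_apply, Finset.sum_eq_single (j + n)]
    · rw [ih, if_pos rfl, mul_one, pauliX, Matrix.of_apply, Nat.cast_succ, add_assoc]
    · intro k _ hk
      simp [ih, hk]
    · simp

theorem pauliZ_pow (n : ℕ) :
    pauliZ p ^ n = Matrix.diagonal fun j : ZMod p => ω (j * (n : ZMod p)) := by
  rw [pauliZ, Matrix.diagonal_pow]
  congr 1
  funext j
  rw [Pi.pow_apply, ω, ω, ← AddChar.map_nsmul_eq_pow, nsmul_eq_mul, mul_comm]

theorem weyl_eq_pauli (s : ZMod p) (a : ZMod p × ZMod p) :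
    weyl s a = pauliX p ^ (s * a.1).val * pauliZ p ^ a.2.val := by
  ext i j
  simp [pauliZ_pow, pauliX_pow, weyl_apply]

/-- The Weyl relation: moving `Z^{a₂}` past `X^{s b₁}` costs `ω^{s a₂ b₁}`. For `s = q - r` this is
the scalar of `endDiagram_mul_F`. -/
theorem weyl_mul_weyl (s : ZMod p) (a b : ZMod p × ZMod p) :
    weyl s a * weyl s b = ω (s * a.2 * b.1) • weyl s (a + b) := by
  ext i j
  rw [Matrix.mul_apply, Finset.sum_eq_single (j + s * b.1)]
  · simp only [weyl_apply, Matrix.smul_apply, if_true, smul_eq_mul, Prod.fst_add, Prod.snd_add]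
    rw [show j + s * b.1 + s * a.1 = j + s * (a.1 + b.1) by ring]
    split_ifs
    · rw [← ω_add, ← ω_add]
      congr 1
      ring
    · simp
  · intro k _ hk
    simp [weyl_apply, hk]
  · simp

theorem weyl_zero (s : ZMod p) : weyl s 0 = 1 := by
  simp [weyl_eq_pauli]

/-- The linear map sending the diagram `[g, h]` to `X ^ (s g) Z ^ h`. -/
noncomputable def weylMap (q r s : ZMod p) :
    End (⟨(), ()⟩ : Ann (F q) (F r)) →ₗ[ℂ] Matrix (ZMod p) (ZMod p) ℂ :=
  Fintype.linearCombination ℂ (weyl s) ∘ₗ coeff _ _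

theorem weylMap_diagram (q r s : ZMod p) (a : ZMod p × ZMod p) :
    weylMap q r s (diagram _ _ a.1 a.2) = weyl s a := by
  change ∑ b, coeff _ _ (diagram _ _ a.1 a.2) b • weyl s b = _
  simp [coeff_diagram (show Composable (⟨(), ()⟩ : Ann (F q) (F r)) ⟨(), ()⟩ a from ⟨rfl, rfl⟩)]

theorem weylMap_mul (q r : ZMod p) (f k : End (⟨(), ()⟩ : Ann (F q) (F r))) :
    weylMap q r (q - r) (f * k) = weylMap q r (q - r) f * weylMap q r (q - r) k := by
  have hf : f = ∑ a : ZMod p × ZMod p,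
      coeff _ _ f a • endDiagram (⟨(), ()⟩ : Ann (F q) (F r)) a.1 a.2 := eq_sum_diagram f
  have hk : k = ∑ a : ZMod p × ZMod p,
      coeff _ _ k a • endDiagram (⟨(), ()⟩ : Ann (F q) (F r)) a.1 a.2 := eq_sum_diagram k
  rw [hf, hk]
  simp only [Finset.sum_mul_sum, map_sum, smul_mul_smul_comm, endDiagram_mul_F, map_smul,
    weylMap_diagram, weyl_mul_weyl]

theorem weylMap_injective (q r : ZMod p) {s : ZMod p} (hs : s ≠ 0) :
    Function.Injective (weylMap q r s) := by
  rw [injective_iff_map_eq_zero]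
  intro f hf
  refine coeff_injective _ _ (funext fun a => ?_)
  -- Since `s ≠ 0`, only diagrams with left string `a.1` reach the entry `(j + s a₁, j)`, which is a
  -- Fourier transform of their coefficients in `h`.
  have entry : ∀ j, ∑ h, coeff _ _ f (a.1, h) * ω (j * h) = 0 := by
    intro j
    have h1 : (∑ b, coeff _ _ f b • weyl s b) (j + s * a.1) j = 0 := congrFun₂ hf (j + s * a.1) j
    rw [Matrix.sum_apply, Fintype.sum_prod_type, Finset.sum_eq_single a.1] at h1
    · simpa [weyl_apply] using h1
    · intro g _ hg
      exact Finset.sum_eq_zero fun h _ => by simp [weyl_apply, hs, Ne.symm hg]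
    · simp
  -- Fourier inversion recovers `p` times the coefficient at `a`.
  have h2 : ∑ j, ω (j * -a.2) * ∑ h, coeff _ _ f (a.1, h) * ω (j * h) = 0 := by simp [entry]
  simp only [Finset.mul_sum] at h2
  rw [Finset.sum_comm, Finset.sum_eq_single a.2] at h2
  · have h3 : ∀ j : ZMod p, ω (j * -a.2) * (coeff _ _ f (a.1, a.2) * ω (j * a.2)) =
        coeff _ _ f (a.1, a.2) := fun j => by
      rw [mul_left_comm, ← ω_add, mul_neg, neg_add_cancel, ω_zero, mul_one]
    rw [Finset.sum_congr rfl fun j _ => h3 j] at h2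
    simpa [NeZero.ne p] using h2
  · intro h _ hh
    have h3 : ∀ j : ZMod p, ω (j * -a.2) * (coeff _ _ f (a.1, h) * ω (j * h)) =
        coeff _ _ f (a.1, h) * ω (j * (h - a.2)) := fun j => by
      rw [mul_left_comm, ← ω_add]
      congr 2
      ring
    simp only [h3]
    rw [← Finset.mul_sum, sum_ω_mul, if_neg (sub_ne_zero.mpr hh), mul_zero]
  · simp

theorem weylMap_surjective (q r : ZMod p) {s : ZMod p} (hs : s ≠ 0) :
    Function.Surjective (weylMap q r s) := by
  -- Every pair of strings gives a diagram here, so both sides have dimension `p²` and injectivity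
  -- suffices.
  let φ : End (⟨(), ()⟩ : Ann (F q) (F r)) ≃ₗ[ℂ] (ZMod p × ZMod p → ℂ) :=
    LinearEquiv.ofBijective (coeff _ _)
      ⟨coeff_injective _ _, fun f => ⟨⟨f, fun a ha => absurd ⟨rfl, rfl⟩ ha⟩, rfl⟩⟩
  have := Module.Finite.equiv φ.symm
  refine (LinearMap.injective_iff_surjective_of_finrank_eq_finrank ?_).mp (weylMap_injective q r hs)
  rw [φ.finrank_eq, Module.finrank_matrix]
  simp

/-- The algebra of endomorphisms of the simple object of `Ann (F q) (F r)` is a matrix algebra. -/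
noncomputable def endAlgEquivMatrix {q r : ZMod p} (hqr : q ≠ r) :
    End (⟨(), ()⟩ : Ann (F q) (F r)) ≃ₐ[ℂ] Matrix (ZMod p) (ZMod p) ℂ :=
  AlgEquiv.ofBijective
    (AlgHom.ofLinearMap (weylMap q r (q - r))
      (by
        rw [← weyl_zero (q - r), ← weylMap_diagram q r]
        exact congrArg _ (diagram_zero _).symm)
      (weylMap_mul q r))
    ⟨weylMap_injective q r (sub_ne_zero.mpr hqr), weylMap_surjective q r (sub_ne_zero.mpr hqr)⟩

theorem endAlgEquivMatrix_diagram {q r : ZMod p} (hqr : q ≠ r) (a : ZMod p × ZMod p) :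
    endAlgEquivMatrix hqr (diagram _ _ a.1 a.2) = weyl (q - r) a :=
  weylMap_diagram q r (q - r) a

/-- Averaging the powers of `Z` projects onto its eigenvalue `1`, that is, onto `e_0`. -/
theorem endAlgEquivMatrix_sum {q r : ZMod p} (hqr : q ≠ r) :
    endAlgEquivMatrix hqr ((1 / p : ℂ) • ∑ g : ZMod p, diagram _ _ 0 g) = Matrix.single 0 0 1 := by
  have h : ∀ g : ZMod p, endAlgEquivMatrix hqr (diagram _ _ 0 g) = weyl (q - r) (0, g) :=
    fun g => endAlgEquivMatrix_diagram hqr (0, g)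
  have hp : (p : ℂ) ≠ 0 := Nat.cast_ne_zero.mpr (NeZero.ne p)
  rw [map_smul, map_sum]
  simp only [h]
  ext i j
  rw [Matrix.smul_apply, Matrix.sum_apply]
  by_cases hij : i = j
  · subst hij
    simp only [weyl_apply, mul_zero, add_zero, if_true, mul_comm i, sum_ω_mul, Matrix.single_apply,
      and_self, eq_comm (a := (0 : ZMod p)) (b := i)]
    split_ifs <;> simp [hp]
  · have : ¬ (0 = i ∧ 0 = j) := fun h => hij (h.1.symm.trans h.2)
    simp [weyl_apply, hij, this]

/-- Under the isomorphism with matrices the idempotent becomes `E₀₀`, which has scalar corner and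
generates the whole algebra as a two-sided ideal. -/
theorem classifiesDefects_F_F_of_ne {q r : ZMod p} (hqr : q ≠ r) :
    ClassifiesDefects (F q) (F r) (fun _ : Unit => ⟨(), ()⟩)
      (fun _ => (1 / p : ℂ) • ∑ g : ZMod p, diagram _ _ 0 (-g)) := by
  set e : End (⟨(), ()⟩ : Ann (F q) (F r)) := (1 / p : ℂ) • ∑ g : ZMod p, diagram _ _ 0 (-g) with he
  set Φ := endAlgEquivMatrix hqr
  have hΦe : Φ e = Matrix.single 0 0 1 := by
    rw [← endAlgEquivMatrix_sum hqr, he]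
    congr 2
    -- The average runs over a group, so the sign of `g` is immaterial.
    exact Equiv.sum_comp (Equiv.neg (ZMod p)) fun g => diagram _ _ 0 g
  refine IsSplitGeneratingFamily.classifiesDefects (A := fun _ : Unit => (⟨(), ()⟩ : Ann (F q) (F r)))
    (e := fun _ => e) ⟨fun _ => ?_, fun _ h0 => ?_, fun i j hij => absurd rfl hij, fun _ f => ?_,
      fun Z => ?_⟩
  · refine Φ.injective ?_
    change Φ (e * e) = Φ e
    rw [map_mul, hΦe, Matrix.single_mul_single_same, one_mul]
  · have h1 : Φ e = 0 := by
      rw [show e = 0 from h0, map_zero]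
    rw [hΦe] at h1
    simpa using congrFun₂ h1 0 0
  · have key : ∀ f : End (⟨(), ()⟩ : Ann (F q) (F r)), Φ (e * f * e) = Φ (Φ f 0 0 • e) := by
      intro f
      rw [map_mul, map_mul, map_smul Φ (Φ f 0 0), hΦe]
      simp [Matrix.single_mul_mul_single, Matrix.smul_single]
    exact ⟨Φ f 0 0, Φ.injective (key f)⟩
  -- The decomposition `1 = ∑ E_{j0} E₀₀ E_{0j}`; as this is the only object, it settles generation.
  · have h1 : (1 : End (⟨(), ()⟩ : Ann (F q) (F r))) =
        ∑ j, Φ.symm (Matrix.single j 0 1) * (e * Φ.symm (Matrix.single 0 j 1)) := by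
      refine Φ.injective ?_
      simp only [map_one, map_sum, map_mul, AlgEquiv.apply_symm_apply, hΦe,
        Matrix.single_mul_single_same, mul_one, Matrix.sum_single_one]
    change (1 : End (⟨(), ()⟩ : Ann (F q) (F r))) ∈ _
    rw [h1]
    exact Submodule.sum_mem _ fun j _ => Submodule.subset_span
      ⟨(), Φ.symm (Matrix.single 0 j 1), Φ.symm (Matrix.single j 0 1), Category.assoc _ _ _⟩


theorem endDiagram_mul_X_F (k r g h : ZMod p) :
    endDiagram (⟨0, ()⟩ : Ann (X k) (F r)) (-(k * g)) g *
      endDiagram (⟨0, ()⟩ : Ann (X k) (F r)) (-(k * h)) h =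
      ω (k * r * g * h) • endDiagram (⟨0, ()⟩ : Ann (X k) (F r)) (-(k * (g + h))) (g + h) := by
  have hc : ∀ g : ZMod p, Composable (⟨0, ()⟩ : Ann (X k) (F r)) ⟨0, ()⟩ (-(k * g), g) :=
    fun g => ⟨by simp [SkeletalBimodule.act], rfl⟩
  rw [End.mul_def]
  refine (diagram_comp (hc h) (hc g)).trans ?_
  rw [phase_eq, assoc_X, assoc_F, ← ω_neg, Units.val_one, one_mul]
  congr 2
  · ring
  · simp only [Prod.mk_add_mk]
    ring
  · simp only [Prod.mk_add_mk]
    ring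

end Wall

/-! ### Assembly of the table and of the two algebra statements. -/

theorem mainTheorem1 (p : ℕ) [Fact p.Prime] :
    -- row `T`
    (ClassifiesDefects (T p) (T p) (fun i : ZMod p × ZMod p => ⟨(0, 0), (i.1, i.2)⟩)
        (fun _ => diagram _ _ 0 0) ∧
      ClassifiesDefects (T p) (L p) (fun a : ZMod p => ⟨(0, 0), a⟩) (fun _ => diagram _ _ 0 0) ∧
      ClassifiesDefects (T p) (R p) (fun a : ZMod p => ⟨(0, 0), a⟩) (fun _ => diagram _ _ 0 0) ∧
      ClassifiesDefects (T p) (F 0) (fun _ : Unit => ⟨(0, 0), ()⟩) (fun _ => diagram _ _ 0 0) ∧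
      (∀ l : ZMod p, l ≠ 0 → ClassifiesDefects (T p) (X l) (fun a : ZMod p => ⟨(0, 0), a⟩)
        (fun _ => diagram _ _ 0 0)) ∧
      (∀ r : ZMod p, r ≠ 0 → ClassifiesDefects (T p) (F r) (fun _ : Unit => ⟨(0, 0), ()⟩)
        (fun _ => diagram _ _ 0 0))) ∧
    -- row `L`
    (ClassifiesDefects (L p) (T p) (fun a : ZMod p => ⟨0, (0, a)⟩) (fun _ => diagram _ _ 0 0) ∧
      ClassifiesDefects (L p) (L p) (fun i : ZMod p × ZMod p => ⟨0, i.1⟩)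
        (fun i => (1 / p : ℂ) • ∑ g : ZMod p, ω (g * i.2) • diagram _ _ g 0) ∧
      ClassifiesDefects (L p) (R p) (fun _ : Unit => ⟨0, 0⟩) (fun _ => diagram _ _ 0 0) ∧
      ClassifiesDefects (L p) (F 0) (fun _ : ZMod p => ⟨0, ()⟩)
        (fun x => (1 / p : ℂ) • ∑ g : ZMod p, ω (g * x) • diagram _ _ g 0) ∧
      (∀ l : ZMod p, l ≠ 0 → ClassifiesDefects (L p) (X l) (fun _ : Unit => ⟨0, 0⟩)
        (fun _ => diagram _ _ 0 0)) ∧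
      (∀ r : ZMod p, r ≠ 0 → ClassifiesDefects (L p) (F r) (fun _ : ZMod p => ⟨0, ()⟩)
        (fun x => (1 / p : ℂ) • ∑ g : ZMod p, ω (g * x) • diagram _ _ g 0))) ∧
    -- row `R`
    (ClassifiesDefects (R p) (T p) (fun a : ZMod p => ⟨0, (a, 0)⟩) (fun _ => diagram _ _ 0 0) ∧
      ClassifiesDefects (R p) (L p) (fun _ : Unit => ⟨0, 0⟩) (fun _ => diagram _ _ 0 0) ∧
      ClassifiesDefects (R p) (R p) (fun i : ZMod p × ZMod p => ⟨0, i.1⟩)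
        (fun i => (1 / p : ℂ) • ∑ g : ZMod p, ω (g * i.2) • diagram _ _ 0 (-g)) ∧
      ClassifiesDefects (R p) (F 0) (fun _ : ZMod p => ⟨0, ()⟩)
        (fun x => (1 / p : ℂ) • ∑ g : ZMod p, ω (g * x) • diagram _ _ 0 (-g)) ∧
      (∀ l : ZMod p, l ≠ 0 → ClassifiesDefects (R p) (X l) (fun _ : Unit => ⟨0, 0⟩)
        (fun _ => diagram _ _ 0 0)) ∧
      (∀ r : ZMod p, r ≠ 0 → ClassifiesDefects (R p) (F r) (fun _ : ZMod p => ⟨0, ()⟩)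
        (fun x => (1 / p : ℂ) • ∑ g : ZMod p, ω (g * x) • diagram _ _ 0 (-g)))) ∧
    -- row `F_0`
    (ClassifiesDefects (F 0) (T p) (fun _ : Unit => ⟨(), (0, 0)⟩) (fun _ => diagram _ _ 0 0) ∧
      ClassifiesDefects (F 0) (L p) (fun _ : ZMod p => ⟨(), 0⟩)
        (fun x => (1 / p : ℂ) • ∑ g : ZMod p, ω (g * x) • diagram _ _ g 0) ∧
      ClassifiesDefects (F 0) (R p) (fun _ : ZMod p => ⟨(), 0⟩)
        (fun x => (1 / p : ℂ) • ∑ g : ZMod p, ω (g * x) • diagram _ _ 0 (-g)) ∧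
      ClassifiesDefects (F (0 : ZMod p)) (F 0) (fun _ : ZMod p × ZMod p => ⟨(), ()⟩)
        (fun i => (1 / (p : ℂ) ^ 2) • ∑ g : ZMod p, ∑ h : ZMod p,
          ω (g * i.1 + h * i.2) • diagram _ _ g (-h)) ∧
      (∀ l : ZMod p, l ≠ 0 → ClassifiesDefects (F 0) (X l) (fun _ : ZMod p => ⟨(), 0⟩)
        (fun x => (1 / p : ℂ) • ∑ g : ZMod p, ω (g * x) • diagram _ _ g (-l⁻¹ * g))) ∧
      (∀ r : ZMod p, r ≠ 0 → ClassifiesDefects (F 0) (F r) (fun _ : Unit => ⟨(), ()⟩)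
        (fun _ => (1 / p : ℂ) • ∑ g : ZMod p, diagram _ _ 0 (-g)))) ∧
    -- row `X_k`
    (∀ k : ZMod p, k ≠ 0 →
      ClassifiesDefects (X k) (T p) (fun a : ZMod p => ⟨0, (a, 0)⟩) (fun _ => diagram _ _ 0 0) ∧
      ClassifiesDefects (X k) (L p) (fun _ : Unit => ⟨0, 0⟩) (fun _ => diagram _ _ 0 0) ∧
      ClassifiesDefects (X k) (R p) (fun _ : Unit => ⟨0, 0⟩) (fun _ => diagram _ _ 0 0) ∧
      ClassifiesDefects (X k) (F 0) (fun _ : ZMod p => ⟨0, ()⟩)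
        (fun x => (1 / p : ℂ) • ∑ g : ZMod p, ω (g * x) • diagram _ _ g (-k⁻¹ * g)) ∧
      ClassifiesDefects (X k) (X k) (fun i : ZMod p × ZMod p => ⟨0, i.1⟩)
        (fun i => (1 / p : ℂ) • ∑ g : ZMod p, ω (g * i.2) • diagram _ _ (k * g) (-g)) ∧
      (∀ l : ZMod p, l ≠ 0 → k ≠ l → ClassifiesDefects (X k) (X l) (fun _ : Unit => ⟨0, 0⟩)
        (fun _ => diagram _ _ 0 0)) ∧
      (∀ r : ZMod p, r ≠ 0 → ClassifiesDefects (X k) (F r) (fun _ : ZMod p => ⟨0, ()⟩)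
        (fun x => (1 / p : ℂ) • ∑ g : ZMod p, Θ x (k * r) g • diagram _ _ (k * g) (-g)))) ∧
    -- row `F_q`
    (∀ q : ZMod p, q ≠ 0 →
      ClassifiesDefects (F q) (T p) (fun _ : Unit => ⟨(), (0, 0)⟩) (fun _ => diagram _ _ 0 0) ∧
      ClassifiesDefects (F q) (L p) (fun _ : ZMod p => ⟨(), 0⟩)
        (fun x => (1 / p : ℂ) • ∑ g : ZMod p, ω (g * x) • diagram _ _ g 0) ∧
      ClassifiesDefects (F q) (R p) (fun _ : ZMod p => ⟨(), 0⟩)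
        (fun x => (1 / p : ℂ) • ∑ g : ZMod p, ω (g * x) • diagram _ _ 0 (-g)) ∧
      ClassifiesDefects (F q) (F 0) (fun _ : Unit => ⟨(), ()⟩)
        (fun _ => (1 / p : ℂ) • ∑ g : ZMod p, diagram _ _ 0 (-g)) ∧
      (∀ l : ZMod p, l ≠ 0 → ClassifiesDefects (F q) (X l) (fun _ : ZMod p => ⟨(), 0⟩)
        (fun x => (1 / p : ℂ) • ∑ g : ZMod p, Θ x (-(q * l)) g • diagram _ _ (l * g) (-g))) ∧
      ClassifiesDefects (F q) (F q) (fun _ : ZMod p × ZMod p => ⟨(), ()⟩)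
        (fun i => (1 / (p : ℂ) ^ 2) • ∑ g : ZMod p, ∑ h : ZMod p,
          ω (g * i.1 + h * i.2) • diagram _ _ g (-h)) ∧
      (∀ r : ZMod p, r ≠ 0 → q ≠ r → ClassifiesDefects (F q) (F r) (fun _ : Unit => ⟨(), ()⟩)
        (fun _ => (1 / p : ℂ) • ∑ g : ZMod p, diagram _ _ 0 (-g)))) ∧
    -- the twisted multiplication of the `X_k`-`F_r` diagrams and its untwisting
    (∀ k r : ZMod p, k ≠ 0 → ∀ M : ZMod p → End (⟨0, ()⟩ : Ann (X k) (F r)),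
      (∀ g, M g = diagram _ _ (-(k * g)) g) →
      (∀ g h, M g * M h = ω (k * r * g * h) • M (g + h)) ∧
      (∀ g h, (Θ 0 (k * r) g • M g) * (Θ 0 (k * r) h • M h) =
        Θ 0 (k * r) (g + h) • M (g + h))) ∧
    -- the `F_q`-`F_r` annular algebra
    (∀ q r : ZMod p, ∀ M : ZMod p → ZMod p → End (⟨(), ()⟩ : Ann (F q) (F r)),
      (∀ g h, M g h = diagram _ _ g h) →
      (∀ g₀ h₀ g₁ h₁, M g₀ h₀ * M g₁ h₁ =
        ω ((q - r) * h₀ * g₁) • M (g₀ + g₁) (h₀ + h₁)) ∧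
      (q ≠ r → ∃ Φ : End (⟨(), ()⟩ : Ann (F q) (F r)) ≃ₐ[ℂ] Matrix (ZMod p) (ZMod p) ℂ,
        (∀ g h, Φ (M g h) = pauliX p ^ ((q - r) * g).val * pauliZ p ^ h.val) ∧
        Φ ((1 / p : ℂ) • ∑ g, M 0 g) = Matrix.single 0 0 1)) := by
  refine ⟨⟨classifiesDefects_T_T, classifiesDefects_T_L, classifiesDefects_T_R,
      classifiesDefects_T_F 0, fun l _ => classifiesDefects_T_X l,
      fun r _ => classifiesDefects_T_F r⟩,
    ⟨classifiesDefects_L_T, classifiesDefects_L_L, classifiesDefects_L_R,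
      classifiesDefects_L_F 0, fun l _ => classifiesDefects_L_X l,
      fun r _ => classifiesDefects_L_F r⟩,
    ⟨classifiesDefects_R_T, classifiesDefects_R_L, classifiesDefects_R_R,
      classifiesDefects_R_F 0, fun l hl => classifiesDefects_R_X hl,
      fun r _ => classifiesDefects_R_F r⟩,
    ⟨classifiesDefects_F_T 0, classifiesDefects_F_L 0, classifiesDefects_F_R 0,
      classifiesDefects_F_F 0, fun l hl => classifiesDefects_F_zero_X hl,
      fun r hr => classifiesDefects_F_F_of_ne hr.symm⟩,
    fun k hk => ⟨classifiesDefects_X_T k, classifiesDefects_X_L k, classifiesDefects_X_R hk,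
      classifiesDefects_X_F_zero hk, classifiesDefects_X_X k,
      fun l _ hkl => classifiesDefects_X_X_of_ne hkl, fun r _ => classifiesDefects_X_F k r⟩,
    fun q hq => ⟨classifiesDefects_F_T q, classifiesDefects_F_L q, classifiesDefects_F_R q,
      classifiesDefects_F_F_of_ne hq, fun l _ => classifiesDefects_F_X q l,
      classifiesDefects_F_F q, fun r _ hqr => classifiesDefects_F_F_of_ne hqr⟩,
    fun k r _ M hM => ?_, fun q r M hM => ⟨fun g₀ h₀ g₁ h₁ => ?_, fun hqr => ?_⟩⟩
  · have mul : ∀ g h, M g * M h = ω (k * r * g * h) • M (g + h) := fun g h => by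
      simpa only [hM] using endDiagram_mul_X_F k r g h
    refine ⟨mul, fun g h => ?_⟩
    rw [smul_mul_smul_comm, mul, smul_smul, Θ_mul]
  · simp only [hM]
    exact endDiagram_mul_F q r (g₀, h₀) (g₁, h₁)
  · refine ⟨endAlgEquivMatrix hqr, fun g h => ?_, ?_⟩
    · rw [hM, ← weyl_eq_pauli (q - r) (g, h)]
      exact endAlgEquivMatrix_diagram hqr (g, h)
    · simp only [hM]
      exact endAlgEquivMatrix_sum hqr
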